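/- Let $k$ be a field of characteristic zero, let $A$ be an associative unital (not necessarily commutative) $k$-algebra, and let $\delta : A \to A$ be a locally nilpotent $k$-linear derivation, i.e. for every $a \in A$ there is an integer $n > 0$ with $\delta^n(a) = 0$. Let $\mathcal{H} = k[x]$ be the Hopf algebra with $\Delta(x) = x \otimes 1 + 1 \otimes x$ and $\epsilon(x) = 0$ (the universal enveloping algebra of the Lie algebra with one generator), acting on $A$ by $x \cdot a = \delta(a)$, so that $A$ is an $\mathcal{H}$-module algebra. Let $A \rtimes \mathcal{H}$ be the crossed product, i.e. $A \otimes \mathcal{H}$ with the product $(a \otimes g)(b \otimes h) = \sum a\,(g^{(0)} \cdot b) \otimes g^{(1)} h$. For a unital $k$-algebra $R$ let $C^n(R) = \mathrm{Hom}_k(R^{\otimes (n+1)}, k)$, and let $HP^*(R)$, $* \in \mathbb{Z}/2$, be the periodic cyclic cohomology of $R$, i.e. the cohomology of the $\mathbb{Z}/2$-graded complex $\bigoplus_{n \ge 0} C^n(R)$ of finitely supported cochains with differential $b + B$, where $b$ and $B$ are the duals of the Hochschild boundary and of Connes' operator $B = (1 - (-1)^{n+1}\tau)\,\sigma N$ (equivalently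 $HP^i(R) = \varinjlim_m HC^{i+2m}(R)$). Then there is an isomorphism of $k$-vector spaces $$HP^*(A \rtimes \mathcal{H}) \cong HP^*(A)$$ in both the even and the odd degree, namely the one induced by the inclusion $A \to A \rtimes \mathcal{H}$, $a \mapsto a \otimes 1$. -/

import Mathlib

open scoped TensorProduct Polynomial DirectSum

noncomputable section

/-! ### Crossed products by a bialgebra -/

section CrossedProduct

/-- An `H`-module algebra structure on the algebra `A`: a left `H`-module structure, given by
`act : H → End_k(A)`, such that `h · (a b) = ∑ (h⁽⁰⁾ · a) (h⁽¹⁾ · b)` and `h · 1 = ε(h) 1`. -/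
structure ModuleAlgebra (k H A : Type*) [CommRing k] [Ring H] [Bialgebra k H]
    [Ring A] [Algebra k A] where
  act : H →ₐ[k] Module.End k A
  act_mul : ∀ (h : H) (a b : A), act h (a * b) =
    LinearMap.mul' k A (TensorProduct.map (act.toLinearMap.flip a) (act.toLinearMap.flip b)
      (Coalgebra.comul (R := k) h))
  act_one : ∀ h : H, act h 1 = algebraMap k A (Coalgebra.counit (R := k) h)

variable {k H A : Type*} [CommRing k] [Ring H] [Bialgebra k H] [Ring A] [Algebra k A]

namespace ModuleAlgebra

variable (α : ModuleAlgebra k H A)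

/-- `twist b g = ∑ (g⁽⁰⁾ · b) ⊗ g⁽¹⁾`. -/
def twist : A →ₗ[k] H →ₗ[k] A ⊗[k] H :=
  LinearMap.mk₂ k
    (fun b g => TensorProduct.map (α.act.toLinearMap.flip b) LinearMap.id
      (Coalgebra.comul (R := k) g))
    (fun b b' g => by
      rw [map_add, TensorProduct.map_add_left, LinearMap.add_apply])
    (fun c b g => by
      rw [map_smul, TensorProduct.map_smul_left, LinearMap.smul_apply])
    (fun b g g' => by simp only [map_add])
    (fun c b g => by simp only [map_smul])

theorem twist_apply (b : A) (g : H) :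
    α.twist b g = TensorProduct.map (α.act.toLinearMap.flip b) LinearMap.id
      (Coalgebra.comul (R := k) g) := rfl

theorem twist_repr (b : A) (g : H) {ι : Type*} (s : Finset ι) (x y : ι → H)
    (h : Coalgebra.comul (R := k) g = ∑ i ∈ s, x i ⊗ₜ[k] y i) :
    α.twist b g = ∑ i ∈ s, α.act (x i) b ⊗ₜ[k] y i := by
  rw [twist_apply, h, map_sum]
  rfl

/-- The crossed product `A ⋊ H`: as a `k`-module it is `A ⊗ H`. -/
def CrossedProduct (_α : ModuleAlgebra k H A) : Type _ := A ⊗[k] H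

instance : AddCommGroup α.CrossedProduct := inferInstanceAs (AddCommGroup (A ⊗[k] H))

instance : Module k α.CrossedProduct := inferInstanceAs (Module k (A ⊗[k] H))

/-- The element `a ⊗ g` of `A ⋊ H`. -/
def tmul (a : A) (g : H) : α.CrossedProduct := (a ⊗ₜ[k] g : A ⊗[k] H)

/-- The multiplication of the crossed product,
`(a ⊗ g) (b ⊗ h) = ∑ a (g⁽⁰⁾ · b) ⊗ g⁽¹⁾ h`. -/
def mulMap : A ⊗[k] H →ₗ[k] A ⊗[k] H →ₗ[k] A ⊗[k] H :=
  TensorProduct.lift <| LinearMap.mk₂ k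
    (fun a g => TensorProduct.lift <| LinearMap.mk₂ k
      (fun b h => TensorProduct.map (LinearMap.mul k A a) ((LinearMap.mul k H).flip h)
        (α.twist b g))
      (fun b b' h => by simp only [map_add, LinearMap.add_apply])
      (fun c b h => by simp only [map_smul, LinearMap.smul_apply])
      (fun b h h' => by
        rw [map_add, TensorProduct.map_add_right, LinearMap.add_apply])
      (fun c b h => by
        rw [map_smul, TensorProduct.map_smul_right, LinearMap.smul_apply]))
    (fun a a' g => TensorProduct.ext' fun b h => by
      simp [TensorProduct.map_add_left])
    (fun c a g => TensorProduct.ext' fun b h => by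
      simp [TensorProduct.map_smul_left])
    (fun a g g' => TensorProduct.ext' fun b h => by simp)
    (fun c a g => TensorProduct.ext' fun b h => by simp)

theorem mulMap_tmul (a b : A) (g h : H) :
    α.mulMap (a ⊗ₜ g) (b ⊗ₜ h) =
      TensorProduct.map (LinearMap.mul k A a) ((LinearMap.mul k H).flip h) (α.twist b g) := rfl

theorem twist_one_left (g : H) : α.twist 1 g = (1 : A) ⊗ₜ[k] g := by
  have e : α.act.toLinearMap.flip 1 =
      (Algebra.linearMap k A) ∘ₗ (Coalgebra.counit (R := k) (A := H)) :=
    LinearMap.ext fun h => α.act_one h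
  have h1 := congrArg (TensorProduct.map (Algebra.linearMap k A) (LinearMap.id (M := H)))
    (Coalgebra.rTensor_counit_comul (R := k) g)
  rw [LinearMap.rTensor, ← LinearMap.comp_apply, ← TensorProduct.map_comp] at h1
  rw [twist_apply, e]
  simpa using h1

theorem twist_one_right (b : A) : α.twist b 1 = b ⊗ₜ[k] (1 : H) := by
  rw [twist_apply, Bialgebra.comul_one, Algebra.TensorProduct.one_def]
  simp

/-- `twist` and the multiplication of `H`. -/
theorem twist_mul_right (c : A) (g h : H) :
    α.twist c (g * h) = TensorProduct.lift (LinearMap.mk₂ k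
      (fun c' h' => TensorProduct.map LinearMap.id ((LinearMap.mul k H).flip h') (α.twist c' g))
      (fun b b' h => by simp only [map_add, LinearMap.add_apply])
      (fun c b h => by simp only [map_smul, LinearMap.smul_apply])
      (fun b h h' => by
        rw [map_add, TensorProduct.map_add_right, LinearMap.add_apply])
      (fun c b h => by
        rw [map_smul, TensorProduct.map_smul_right, LinearMap.smul_apply])) (α.twist c h) := by
  obtain ⟨s, hs⟩ := TensorProduct.exists_finset (Coalgebra.comul (R := k) g)
  obtain ⟨t, ht⟩ := TensorProduct.exists_finset (Coalgebra.comul (R := k) h)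
  have hgh : Coalgebra.comul (R := k) (g * h) =
      ∑ p ∈ s ×ˢ t, (p.1.1 * p.2.1) ⊗ₜ[k] (p.1.2 * p.2.2) := by
    rw [Bialgebra.comul_mul, hs, ht, Finset.sum_mul_sum, Finset.sum_product]
    simp only [Algebra.TensorProduct.tmul_mul_tmul]
  rw [α.twist_repr c (g * h) _ _ _ hgh, α.twist_repr c h _ _ _ ht, map_sum,
    Finset.sum_product_right]
  refine Finset.sum_congr rfl fun q _ => ?_
  rw [TensorProduct.lift.tmul, LinearMap.mk₂_apply, α.twist_repr _ g _ _ _ hs, map_sum]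
  refine Finset.sum_congr rfl fun p _ => ?_
  simp

/-- `twist` and the multiplication of `A`. -/
theorem twist_mul_left (a b : A) (g : H) :
    α.twist (a * b) g = TensorProduct.lift (LinearMap.mk₂ k
      (fun a' g' => TensorProduct.map (LinearMap.mul k A a') LinearMap.id (α.twist b g'))
      (fun a a' g => by rw [map_add, TensorProduct.map_add_left, LinearMap.add_apply])
      (fun c a g => by rw [map_smul, TensorProduct.map_smul_left, LinearMap.smul_apply])
      (fun a g g' => by simp only [map_add])
      (fun c a g => by simp only [map_smul])) (α.twist a g) := by
  set M : H ⊗[k] H →ₗ[k] A := LinearMap.mul' k A ∘ₗ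
    TensorProduct.map (α.act.toLinearMap.flip a) (α.act.toLinearMap.flip b) with hM
  have e : α.act.toLinearMap.flip (a * b) = M ∘ₗ Coalgebra.comul (R := k) (A := H) :=
    LinearMap.ext fun h => α.act_mul h a b
  have hco := Coalgebra.coassoc_apply (R := k) g
  obtain ⟨s, hs⟩ := TensorProduct.exists_finset (Coalgebra.comul (R := k) g)
  rw [hs, map_sum, map_sum, map_sum] at hco
  have hco' := congrArg (TensorProduct.map M (LinearMap.id (M := H)) ∘
    (TensorProduct.assoc k H H H).symm) hco
  simp only [Function.comp_apply, map_sum, LinearEquiv.symm_apply_apply] at hco'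
  rw [twist_apply, e, hs, map_sum, α.twist_repr a g _ _ _ hs, map_sum]
  refine Eq.trans (Finset.sum_congr rfl fun p _ => ?_)
    (hco'.trans (Finset.sum_congr rfl fun p _ => ?_))
  · simp
  · rw [TensorProduct.lift.tmul, LinearMap.mk₂_apply, LinearMap.lTensor_tmul]
    obtain ⟨t, ht⟩ := TensorProduct.exists_finset (Coalgebra.comul (R := k) p.2)
    rw [α.twist_repr b p.2 _ _ _ ht, ht, TensorProduct.tmul_sum, map_sum, map_sum, map_sum]
    refine Finset.sum_congr rfl fun q _ => ?_
    simp [hM]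

theorem mulMap_assoc (x y z : A ⊗[k] H) :
    α.mulMap (α.mulMap x y) z = α.mulMap x (α.mulMap y z) := by
  induction x with
  | zero => simp
  | add x x' hx hx' => simp only [map_add, LinearMap.add_apply, hx, hx']
  | tmul a g =>
  induction y with
  | zero => simp
  | add y y' hy hy' => simp only [map_add, LinearMap.add_apply, hy, hy']
  | tmul b h =>
  induction z with
  | zero => simp
  | add z z' hz hz' => simp only [map_add, hz, hz']
  | tmul c l =>
  obtain ⟨s, hs⟩ := TensorProduct.exists_finset (α.twist b g)
  obtain ⟨t, ht⟩ := TensorProduct.exists_finset (α.twist c h)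
  simp only [mulMap_tmul, hs, ht, map_sum, LinearMap.sum_apply, TensorProduct.map_tmul,
    LinearMap.mul_apply', LinearMap.flip_apply, twist_mul_right, twist_mul_left,
    TensorProduct.lift.tmul, LinearMap.mk₂_apply]
  rw [Finset.sum_comm]
  refine Finset.sum_congr rfl fun q _ => Finset.sum_congr rfl fun p _ => ?_
  generalize α.twist q.1 p.2 = w
  induction w with
  | zero => simp
  | add w w' hw hw' => simp only [map_add, hw, hw']
  | tmul d m => simp [mul_assoc]

theorem one_mulMap (x : A ⊗[k] H) : α.mulMap (1 ⊗ₜ 1) x = x := by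
  induction x with
  | zero => simp
  | add x y hx hy => rw [map_add, hx, hy]
  | tmul a g => simp [mulMap_tmul, twist_one_right]

theorem mulMap_one (x : A ⊗[k] H) : α.mulMap x (1 ⊗ₜ 1) = x := by
  induction x with
  | zero => simp
  | add x y hx hy => rw [map_add, LinearMap.add_apply, hx, hy]
  | tmul a g => simp [mulMap_tmul, twist_one_left]

instance : Ring α.CrossedProduct :=
  { (inferInstance : AddCommGroup α.CrossedProduct) with
    mul := fun x y => α.mulMap x y
    one := α.tmul 1 1
    mul_assoc := α.mulMap_assoc
    one_mul := α.one_mulMap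
    mul_one := α.mulMap_one
    left_distrib := fun x y z => map_add (α.mulMap x) y z
    right_distrib := fun x y z => LinearMap.map_add₂ α.mulMap x y z
    zero_mul := fun x => LinearMap.map_zero₂ α.mulMap x
    mul_zero := fun x => map_zero (α.mulMap x) }

instance : Algebra k α.CrossedProduct :=
  Algebra.ofModule (fun c x y => LinearMap.map_smul₂ α.mulMap c x y)
    (fun c x y => map_smul (α.mulMap x) c y)

theorem mul_def (x y : α.CrossedProduct) : x * y = α.mulMap x y := rfl

theorem one_def : (1 : α.CrossedProduct) = α.tmul 1 1 := rfl

/-- The canonical inclusion `A → A ⋊ H`, `a ↦ a ⊗ 1`. -/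
def incl : A →ₐ[k] α.CrossedProduct :=
  AlgHom.ofLinearMap ((TensorProduct.mk k A H).flip 1) rfl (fun a b => by
    rw [mul_def]
    change (a * b) ⊗ₜ[k] (1 : H) = α.mulMap (a ⊗ₜ[k] (1 : H)) (b ⊗ₜ[k] (1 : H))
    rw [mulMap_tmul, twist_one_right]
    simp)

theorem incl_apply (a : A) : α.incl a = α.tmul a 1 := rfl

end ModuleAlgebra

end CrossedProduct

/-! ### The Hopf algebra `k[x]` with `x` primitive, acting through a derivation -/

section PolynomialHopf

variable (k : Type*) [CommRing k]

/-- The coproduct `Δ(x) = x ⊗ 1 + 1 ⊗ x` and counit `ε(x) = 0` of `k[x]`, the universal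
enveloping algebra of the (free) Lie algebra on one generator. -/
instance polynomialBialgebra : Bialgebra k k[X] :=
  Bialgebra.ofAlgHom
    (Polynomial.aeval ((Polynomial.X : k[X]) ⊗ₜ[k] (1 : k[X]) + 1 ⊗ₜ[k] Polynomial.X))
    (Polynomial.aeval (0 : k))
    (by ext; simp [TensorProduct.add_tmul, TensorProduct.tmul_add,
          Algebra.TensorProduct.one_def, add_assoc])
    (by ext; simp)
    (by ext; simp)

theorem polynomial_comul_X : Coalgebra.comul (R := k) (Polynomial.X : k[X]) =
    Polynomial.X ⊗ₜ[k] 1 + 1 ⊗ₜ[k] Polynomial.X :=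
  Polynomial.aeval_X _

theorem polynomial_counit_X : Coalgebra.counit (R := k) (Polynomial.X : k[X]) = 0 :=
  Polynomial.aeval_X _

/-- The antipode is `S(x) = -x`. -/
instance polynomialHopfAlgebra : HopfAlgebra k k[X] :=
  HopfAlgebra.ofAlgHom (Polynomial.aeval (-Polynomial.X))
    (Polynomial.algHom_ext (by
      simp only [AlgHom.comp_apply, Bialgebra.comulAlgHom_apply, Bialgebra.counitAlgHom_apply,
        polynomial_comul_X, polynomial_counit_X, map_add, map_zero]
      erw [Algebra.TensorProduct.lift_tmul, Algebra.TensorProduct.lift_tmul]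
      simp))
    (Polynomial.algHom_ext (by
      simp [polynomial_comul_X, polynomial_counit_X]))

variable {k} {A : Type*} [Ring A] [Algebra k A]

/-- A derivation `δ` of `A` makes `A` a `k[x]`-module algebra, `x` acting as `δ`. -/
def derivationAction (δ : A →ₗ[k] A) (hδ : ∀ a b, δ (a * b) = δ a * b + a * δ b) :
    ModuleAlgebra k k[X] A where
  act := Polynomial.aeval δ
  act_mul := by
    intro h
    induction h using Polynomial.induction_on' with
    | add p q hp hq =>
      intro a b
      simp only [map_add, LinearMap.add_apply, hp, hq]
    | monomial n c =>
      rw [← Polynomial.C_mul_X_pow_eq_monomial, ← Polynomial.smul_eq_C_mul]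
      suffices h : ∀ a b, (Polynomial.aeval δ) (Polynomial.X ^ n : k[X]) (a * b) =
          LinearMap.mul' k A (TensorProduct.map ((Polynomial.aeval δ).toLinearMap.flip a)
            ((Polynomial.aeval δ).toLinearMap.flip b)
            (Coalgebra.comul (R := k) (Polynomial.X ^ n : k[X]))) by
        intro a b
        simp only [map_smul, LinearMap.smul_apply, h]
      clear c
      induction n with
      | zero =>
        intro a b
        simp [Algebra.TensorProduct.one_def]
      | succ n ih =>
        intro a b
        have key : ∀ z : k[X] ⊗[k] k[X],
            LinearMap.mul' k A (TensorProduct.map ((Polynomial.aeval δ).toLinearMap.flip a)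
              ((Polynomial.aeval δ).toLinearMap.flip b)
                (z * (Polynomial.X ⊗ₜ[k] 1 + 1 ⊗ₜ[k] Polynomial.X))) =
            LinearMap.mul' k A (TensorProduct.map ((Polynomial.aeval δ).toLinearMap.flip (δ a))
              ((Polynomial.aeval δ).toLinearMap.flip b) z) +
            LinearMap.mul' k A (TensorProduct.map ((Polynomial.aeval δ).toLinearMap.flip a)
              ((Polynomial.aeval δ).toLinearMap.flip (δ b)) z) := by
          intro z
          induction z with
          | zero => simp
          | add z w hz hw =>
            rw [add_mul, map_add, map_add, hz, hw]
            simp only [map_add]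
            abel
          | tmul p q => simp [mul_add]
        rw [pow_succ, Bialgebra.comul_mul, polynomial_comul_X, key, ← ih, ← ih,
          map_mul (Polynomial.aeval δ), Module.End.mul_apply, Polynomial.aeval_X, hδ, map_add]
  act_one := by
    have h0 : δ 1 = 0 := by simpa using hδ 1 1
    intro h
    induction h using Polynomial.induction_on' with
    | add p q hp hq => simp only [map_add, LinearMap.add_apply, hp, hq]
    | monomial n c =>
      rw [← Polynomial.C_mul_X_pow_eq_monomial, ← Polynomial.smul_eq_C_mul, map_smul,
        LinearMap.smul_apply, map_smul, Bialgebra.counit_pow, polynomial_counit_X]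
      cases n with
      | zero => simp [Algebra.smul_def]
      | succ n => simp [pow_succ, h0]

end PolynomialHopf

/-! ### Periodic cyclic cohomology -/

section PeriodicCyclic

variable (k A : Type*) [CommRing k] [Ring A] [Algebra k A]

/-- The Hochschild cochains `Cⁿ(A) = Hom_k(A^{⊗(n+1)}, k)`. -/
abbrev CyclicCochain (n : ℕ) : Type _ := MultilinearMap k (fun _ : Fin (n + 1) => A) k

namespace CyclicCochain

variable {A}

theorem exists_contractNth_update {n : ℕ} (i : Fin (n + 1)) (v : Fin (n + 2) → A)
    (m : Fin (n + 2)) : ∃ (j : Fin (n + 1)) (L : A →ₗ[k] A), ∀ x,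
      Fin.contractNth i.castSucc (· * ·) (Function.update v m x) =
        Function.update (Fin.contractNth i.castSucc (· * ·) v) j (L x) := by
  have hm := m.isLt
  have hi := i.isLt
  rcases lt_trichotomy (m : ℕ) i with h | h | h
  · refine ⟨⟨m, by omega⟩, LinearMap.id, fun x => funext fun l => ?_⟩
    simp only [Fin.contractNth, Function.update_apply, Fin.ext_iff, Fin.val_castSucc,
      Fin.val_succ, LinearMap.id_apply]
    split_ifs <;> first | rfl | omega
  · refine ⟨i, LinearMap.mulRight k (v i.succ), fun x => funext fun l => ?_⟩
    rcases lt_trichotomy (l : ℕ) i with hl | hl | hl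
    · simp only [Fin.contractNth, Function.update_apply, Fin.ext_iff, Fin.val_castSucc,
        Fin.val_succ]
      split_ifs <;> first | rfl | omega
    · obtain rfl : l = i := Fin.ext hl
      obtain rfl : m = l.castSucc := Fin.ext h
      simp [Fin.contractNth, Fin.ext_iff]
    · simp only [Fin.contractNth, Function.update_apply, Fin.ext_iff, Fin.val_castSucc,
        Fin.val_succ]
      split_ifs <;> first | rfl | omega
  · rcases Nat.eq_or_lt_of_le (Nat.succ_le_of_lt h) with h' | h'
    · refine ⟨i, LinearMap.mulLeft k (v i.castSucc), fun x => funext fun l => ?_⟩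
      rcases lt_trichotomy (l : ℕ) i with hl | hl | hl
      · simp only [Fin.contractNth, Function.update_apply, Fin.ext_iff, Fin.val_castSucc,
          Fin.val_succ]
        split_ifs <;> first | rfl | omega
      · obtain rfl : l = i := Fin.ext hl
        obtain rfl : m = l.succ := Fin.ext (by simp [← h'])
        simp [Fin.contractNth, Fin.ext_iff]
      · simp only [Fin.contractNth, Function.update_apply, Fin.ext_iff, Fin.val_castSucc,
          Fin.val_succ]
        split_ifs <;> first | rfl | omega
    · refine ⟨⟨m - 1, by omega⟩, LinearMap.id, fun x => funext fun l => ?_⟩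
      simp only [Fin.contractNth, Function.update_apply, Fin.ext_iff, Fin.val_castSucc,
        Fin.val_succ, LinearMap.id_apply]
      split_ifs <;> first | rfl | omega

variable {k}

/-- The dual of the `i`-th face operator, `0 ≤ i ≤ n`:
`(∂ᵢ φ)(a₀, …, aₙ₊₁) = φ(a₀, …, aᵢ aᵢ₊₁, …, aₙ₊₁)`. -/
def face {n : ℕ} (i : Fin (n + 1)) : CyclicCochain k A n →ₗ[k] CyclicCochain k A (n + 1) where
  toFun φ :=
    { toFun := fun v => φ (Fin.contractNth i.castSucc (· * ·) v)
      map_update_add' := by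
        intro _ v m x y
        obtain rfl : ‹DecidableEq (Fin (n + 1 + 1))› = instDecidableEqFin _ := Subsingleton.elim _ _
        obtain ⟨j, L, h⟩ := exists_contractNth_update k i v m
        simp only [h, map_add, MultilinearMap.map_update_add]
      map_update_smul' := by
        intro _ v m c x
        obtain rfl : ‹DecidableEq (Fin (n + 1 + 1))› = instDecidableEqFin _ := Subsingleton.elim _ _
        obtain ⟨j, L, h⟩ := exists_contractNth_update k i v m
        simp only [h, map_smul, MultilinearMap.map_update_smul] }
  map_add' _ _ := rfl
  map_smul' _ _ := rfl

/-- The dual of the cyclic operator: `(τ φ)(a₀, …, aₙ) = φ(aₙ, a₀, …, aₙ₋₁)`. -/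
def cyc (n : ℕ) : CyclicCochain k A n →ₗ[k] CyclicCochain k A n :=
  (MultilinearMap.domDomCongrLinearEquiv k k A k (finRotate (n + 1)).symm).toLinearMap

/-- The dual of the extra degeneracy: `(σ φ)(a₀, …, aₙ) = φ(1, a₀, …, aₙ)`. -/
def extraDegen (n : ℕ) : CyclicCochain k A (n + 1) →ₗ[k] CyclicCochain k A n where
  toFun φ := φ.curryLeft 1
  map_add' _ _ := rfl
  map_smul' _ _ := rfl

/-- The Hochschild coboundary, dual to `b = ∑_{i=0}^{n+1} (-1)^i ∂ᵢ` with `∂ₙ₊₁ = ∂₀ τ`. -/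
def b (n : ℕ) : CyclicCochain k A n →ₗ[k] CyclicCochain k A (n + 1) :=
  ∑ i : Fin (n + 1), (-1 : k) ^ (i : ℕ) • face i + (-1 : k) ^ (n + 1) • cyc (n + 1) ∘ₗ face 0

/-- The dual of the norm operator `N = ∑_{i=0}^n (-1)^{in} τ^i`. -/
def norm (n : ℕ) : CyclicCochain k A n →ₗ[k] CyclicCochain k A n :=
  ∑ i ∈ Finset.range (n + 1), (-1 : k) ^ (i * n) • cyc n ^ i

/-- Connes' operator, dual to `B = (1 - (-1)^{n+1} τ) σ N`. -/
def B (n : ℕ) : CyclicCochain k A (n + 1) →ₗ[k] CyclicCochain k A n :=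
  norm n ∘ₗ extraDegen n ∘ₗ (LinearMap.id - (-1 : k) ^ (n + 1) • cyc (n + 1))

theorem face_apply {n : ℕ} (i : Fin (n + 1)) (φ : CyclicCochain k A n) (v : Fin (n + 2) → A) :
    face i φ v = φ (Fin.contractNth i.castSucc (· * ·) v) := rfl

theorem cyc_apply {n : ℕ} (φ : CyclicCochain k A n) (v : Fin (n + 1) → A) :
    cyc n φ v = φ (fun i => v (i - 1)) := by
  simp [cyc]

theorem extraDegen_apply {n : ℕ} (φ : CyclicCochain k A (n + 1)) (v : Fin (n + 1) → A) :
    extraDegen n φ v = φ (Fin.cons 1 v : Fin (n + 2) → A) := rfl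

end CyclicCochain

/-- The finitely supported cochains `⨁ₙ Cⁿ(A)`. -/
abbrev PeriodicCochain : Type _ := ⨁ n : ℕ, CyclicCochain k A n

instance : AddCommGroup (PeriodicCochain k A) := inferInstance

namespace PeriodicCochain

/-- The component `Cⁿ → ⨁ C` of Connes' operator; it is zero on `C⁰`. -/
def BComponent : (n : ℕ) → CyclicCochain k A n →ₗ[k] PeriodicCochain k A
  | 0 => 0
  | n + 1 => DirectSum.lof k ℕ (CyclicCochain k A) n ∘ₗ CyclicCochain.B n

/-- The differential `b + B`. -/
def d : PeriodicCochain k A →ₗ[k] PeriodicCochain k A :=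
  DirectSum.toModule k ℕ _ fun n =>
    DirectSum.lof k ℕ (CyclicCochain k A) (n + 1) ∘ₗ CyclicCochain.b n + BComponent k A n

/-- The cochains concentrated in degrees of the parity `p`. -/
def ofParity (p : ZMod 2) : Submodule k (PeriodicCochain k A) where
  carrier := {x | ∀ n : ℕ, (n : ZMod 2) ≠ p → x n = 0}
  zero_mem' _ _ := rfl
  add_mem' hx hy n hn := by rw [DirectSum.add_apply, hx n hn, hy n hn, add_zero]
  smul_mem' c x hx n hn := by rw [DirectSum.smul_apply, hx n hn, smul_zero]

/-- The cocycles of parity `p` for `b + B`. -/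
def cocycles (p : ZMod 2) : Submodule k (PeriodicCochain k A) :=
  ofParity k A p ⊓ LinearMap.ker (d k A)

/-- The coboundaries of parity `p` for `b + B`. -/
def coboundaries (p : ZMod 2) : Submodule k (PeriodicCochain k A) :=
  (ofParity k A (p + 1)).map (d k A)

end PeriodicCochain

/-- The periodic cyclic cohomology `HP^p(A)`, `p ∈ ℤ/2`. -/
abbrev HP (p : ZMod 2) : Type _ :=
  PeriodicCochain.cocycles k A p ⧸
    (PeriodicCochain.coboundaries k A p).comap (PeriodicCochain.cocycles k A p).subtype

variable {k A} {A' : Type*} [Ring A'] [Algebra k A'] (f : A →ₐ[k] A')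

/-- The pullback of cochains along an algebra homomorphism. -/
def CyclicCochain.pullback (n : ℕ) : CyclicCochain k A' n →ₗ[k] CyclicCochain k A n :=
  MultilinearMap.compLinearMapₗ fun _ => f.toLinearMap

theorem CyclicCochain.pullback_apply (n : ℕ) (φ : CyclicCochain k A' n) (v : Fin (n + 1) → A) :
    pullback f n φ v = φ (f ∘ v) := rfl

theorem CyclicCochain.pullback_face {n : ℕ} (i : Fin (n + 1)) (φ : CyclicCochain k A' n) :
    pullback f (n + 1) (face i φ) = face i (pullback f n φ) := by
  ext v
  simp only [pullback_apply, face_apply]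
  congr 1
  funext j
  simp only [Fin.contractNth, Function.comp_apply]
  split_ifs <;> simp

theorem CyclicCochain.pullback_cyc {n : ℕ} (φ : CyclicCochain k A' n) :
    pullback f n (cyc n φ) = cyc n (pullback f n φ) := by
  ext v
  simp only [pullback_apply, cyc_apply]
  rfl

theorem CyclicCochain.pullback_extraDegen {n : ℕ} (φ : CyclicCochain k A' (n + 1)) :
    pullback f n (extraDegen n φ) = extraDegen n (pullback f (n + 1) φ) := by
  ext v
  simp only [pullback_apply, extraDegen_apply]
  congr 1
  funext j
  cases j using Fin.cases <;> simp

theorem CyclicCochain.pullback_b {n : ℕ} (φ : CyclicCochain k A' n) :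
    pullback f (n + 1) (b n φ) = b n (pullback f n φ) := by
  simp only [b, LinearMap.add_apply, LinearMap.sum_apply, LinearMap.smul_apply, map_add, map_sum,
    map_smul, LinearMap.comp_apply, pullback_face, pullback_cyc]

theorem CyclicCochain.pullback_B {n : ℕ} (φ : CyclicCochain k A' (n + 1)) :
    pullback f n (B n φ) = B n (pullback f (n + 1) φ) := by
  have h : ∀ (i : ℕ) (ψ : CyclicCochain k A' n),
      pullback f n ((cyc n ^ i) ψ) = (cyc n ^ i) (pullback f n ψ) := by
    intro i
    induction i with
    | zero => intro ψ; rfl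
    | succ i ih => intro ψ; rw [pow_succ, Module.End.mul_apply, ih, pullback_cyc]; rfl
  simp only [B, norm, LinearMap.comp_apply, LinearMap.sum_apply, LinearMap.smul_apply, map_sum,
    map_smul, h, pullback_extraDegen, LinearMap.sub_apply, LinearMap.id_apply, map_sub,
    pullback_cyc]

namespace PeriodicCochain

/-- The pullback of finitely supported cochains along an algebra homomorphism. -/
def pullback : PeriodicCochain k A' →ₗ[k] PeriodicCochain k A :=
  DirectSum.lmap (CyclicCochain.pullback f)

theorem pullback_d (x : PeriodicCochain k A') :
    pullback f (d k A' x) = d k A (pullback f x) := by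
  induction x using DirectSum.induction_on with
  | zero => simp
  | add x y hx hy => simp only [map_add, hx, hy]
  | of n φ =>
    change pullback f (d k A' (DirectSum.lof k ℕ _ n φ)) =
      d k A (pullback f (DirectSum.lof k ℕ _ n φ))
    rw [pullback, DirectSum.lmap_lof, d, d, DirectSum.toModule_lof, DirectSum.toModule_lof]
    cases n with
    | zero =>
      simp only [BComponent, LinearMap.comp_apply, add_zero, DirectSum.lmap_lof,
        CyclicCochain.pullback_b]
    | succ n =>
      simp only [BComponent, LinearMap.add_apply, LinearMap.comp_apply, map_add,
        DirectSum.lmap_lof, CyclicCochain.pullback_b, CyclicCochain.pullback_B]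

theorem pullback_mem_ofParity {p : ZMod 2} {x : PeriodicCochain k A'}
    (hx : x ∈ ofParity k A' p) : pullback f x ∈ ofParity k A p := by
  intro n hn
  rw [pullback, DirectSum.lmap_apply, hx n hn, map_zero]

theorem pullback_mem_cocycles {p : ZMod 2} (x : PeriodicCochain k A')
    (hx : x ∈ cocycles k A' p) : pullback f x ∈ cocycles k A p :=
  ⟨pullback_mem_ofParity f hx.1, LinearMap.mem_ker.2 <| by
    rw [← pullback_d, LinearMap.mem_ker.1 hx.2, map_zero]⟩

end PeriodicCochain

/-- The map `HP^p(A') → HP^p(A)` induced by an algebra homomorphism `A → A'`. -/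
def HP.map (p : ZMod 2) : HP k A' p →ₗ[k] HP k A p :=
  Submodule.mapQ _ _
    ((PeriodicCochain.pullback f).restrict (PeriodicCochain.pullback_mem_cocycles f)) (by
      rintro ⟨x, hx⟩ ⟨y, hy, hyx⟩
      exact ⟨PeriodicCochain.pullback f y, PeriodicCochain.pullback_mem_ofParity f hy, by
        rw [← PeriodicCochain.pullback_d, hyx]; rfl⟩)

end PeriodicCyclic

end

/-!
The crossed product `E = A ⋊ k[x]` is the Ore extension `A[x; δ]`: its elements are uniquely sums
of monomials `a xᵐ`, and `x a = a x + δ(a)`. Cochains of `A` extend to `E` along a linear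
retraction, so the claim is that the relative complex, the cochains of `E` whose restriction to `A`
is zero, is acyclic for `b + B`.

*Hochschild cohomology.* An element of `Cⁿ(E)` is a Hochschild `n`-cochain with values in `Hom_k(E,
k)`. It is said to vanish on words in `A` if it does so whenever its `n` arguments lie in `A`,
whatever the argument of the values (`OreExtension.VanishesOnBase`). The exact sequence of
bimodules `0 → E ⊗_A E → E ⊗_A E → E → 0`, whose first map is the commutator with `x`, relates the
Hochschild cohomology of `E` to that of `A`, both with values in `Hom_k(E, k)`. The connecting
homomorphism is realised on cochains by `OreExtension.transgress`: a cochain is restricted to words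
in `A`, extended to a left `A`-linear cochain (`OreExtension.extend`) and contracted along `d(xᵐ) =
∑ x^{m-1-l} dx xˡ` (`OreExtension.contract`). It commutes with the coboundary up to sign, and a
cocycle that vanishes on words in `A` is a coboundary plus a transgression
(`OreExtension.exists_eq_coboundary_add_transgress`).

*Connes' operator.* On words in `A`, the operator `B` applied to the transgression of `f` is
`OreExtension.symbol f`, whose value at `a xᵐ` is `m` times the value of `f` at `a x^{m-1}`, up to
values of `f` at lower powers of `x`. In characteristic zero this triangular operator is a
bijection from the cochains restricted to words in `A` onto those that moreover vanish on `A`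
(`OreExtension.vanishesOnBase_of_symbol`, `OreExtension.exists_symbol_eq`). Consequently `B` is
exact on relative Hochschild cohomology (`OreExtension.exists_eq_connes_add_coboundary`).

*Periodic cohomology.* The top component of a relative cocycle for `b + B` satisfies the conditions
of this exactness statement, so it can be removed by a relative coboundary; cochains being finitely
supported, induction on the top degree shows that the relative complex is acyclic
(`OreExtension.exists_d_eq_of_pullback_eq_zero`).
-/

open scoped TensorProduct Polynomial DirectSum

noncomputable section

/-! ### Ore extensions -/

/-- `E` is presented as the Ore extension `A[x; δ]`: every element is uniquely a finite sum of
monomials `a xᵐ`, with coefficients on the left, and `x a = a x + δ(a)`. -/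
structure OreExtension {k A : Type*} [Field k] [Ring A] [Algebra k A] (δ : A →ₗ[k] A)
    (E : Type*) [Ring E] [Algebra k E] where
  incl : A →ₐ[k] E
  var : E
  coeff : E ≃ₗ[k] (ℕ →₀ A)
  coeff_monomial : ∀ a m, coeff (incl a * var ^ m) = Finsupp.single m a
  var_mul_incl : ∀ a, var * incl a = incl a * var + incl (δ a)

namespace OreExtension

variable {k A E : Type*} [Field k] [Ring A] [Algebra k A] {δ : A →ₗ[k] A} [Ring E] [Algebra k E]
  (O : OreExtension δ E) {P P' : Type*} [AddCommGroup P] [Module k P] [AddCommGroup P']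
  [Module k P']

/-- The linear map on `A[x; δ]` with value `h m a` on the monomial `a xᵐ`. -/
noncomputable def lift (h : ℕ → A →ₗ[k] P) : E →ₗ[k] P :=
  Finsupp.lsum k h ∘ₗ O.coeff.toLinearMap

@[simp]
theorem lift_monomial (h : ℕ → A →ₗ[k] P) (a : A) (m : ℕ) :
    O.lift h (O.incl a * O.var ^ m) = h m a := by
  simp [lift, coeff_monomial]

@[simp]
theorem lift_incl (h : ℕ → A →ₗ[k] P) (a : A) : O.lift h (O.incl a) = h 0 a := by
  simpa using O.lift_monomial h a 0

@[elab_as_elim]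
theorem induction {p : E → Prop} (mon : ∀ a m, p (O.incl a * O.var ^ m)) (zero : p 0)
    (add : ∀ u v, p u → p v → p (u + v)) (e : E) : p e := by
  obtain ⟨f, rfl⟩ := O.coeff.symm.surjective e
  induction f using Finsupp.induction_linear with
  | zero => simpa using zero
  | add f g hf hg => rw [map_add]; exact add _ _ hf hg
  | single m a =>
    have := mon a m
    rwa [← O.coeff.symm_apply_apply (O.incl a * O.var ^ m), coeff_monomial] at this

theorem hom_ext {f g : E →ₗ[k] P} (h : ∀ a m, f (O.incl a * O.var ^ m) = g (O.incl a * O.var ^ m)) :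
    f = g := by
  ext e
  induction e using O.induction with
  | mon a m => exact h a m
  | zero => simp
  | add u v hu hv => rw [map_add, map_add, hu, hv]

theorem lift_add (h h' : ℕ → A →ₗ[k] P) : O.lift (fun m => h m + h' m) = O.lift h + O.lift h' :=
  O.hom_ext fun a m => by simp

theorem lift_smul (c : k) (h : ℕ → A →ₗ[k] P) : O.lift (fun m => c • h m) = c • O.lift h :=
  O.hom_ext fun a m => by simp

theorem lift_zero : O.lift (fun _ => (0 : A →ₗ[k] P)) = 0 :=
  O.hom_ext fun a m => by simp

theorem map_lift (L : P →ₗ[k] P') (h : ℕ → A →ₗ[k] P) (e : E) :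
    L (O.lift h e) = O.lift (fun m => L ∘ₗ h m) e := by
  have : L ∘ₗ O.lift h = O.lift (fun m => L ∘ₗ h m) := O.hom_ext fun a m => by simp
  exact LinearMap.congr_fun this e

/-- Commuting `xⁿ` past a coefficient only creates monomials of degree less than `n`. -/
theorem pow_mul_monomial_mem (n : ℕ) (a : A) :
    O.var ^ n * O.incl a - O.incl a * O.var ^ n ∈
      Submodule.span k {e | ∃ c : A, ∃ i < n, e = O.incl c * O.var ^ i} := by
  induction n with
  | zero => simp
  | succ n ih =>
    have hs : ∀ e ∈ Submodule.span k {e | ∃ c : A, ∃ i < n, e = O.incl c * O.var ^ i},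
        O.var * e ∈ Submodule.span k {e | ∃ c : A, ∃ i < n + 1, e = O.incl c * O.var ^ i} := by
      intro e he
      induction he using Submodule.span_induction with
      | mem e he =>
        obtain ⟨c, i, hi, rfl⟩ := he
        rw [← mul_assoc, O.var_mul_incl, add_mul, mul_assoc, ← pow_succ']
        exact add_mem (Submodule.subset_span ⟨c, i + 1, by omega, rfl⟩)
          (Submodule.subset_span ⟨δ c, i, by omega, rfl⟩)
      | zero => simp
      | add u v _ _ hu hv => rw [mul_add]; exact add_mem hu hv
      | smul c u _ hu => rw [mul_smul_comm]; exact Submodule.smul_mem _ _ hu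
    have e : O.var ^ (n + 1) * O.incl a - O.incl a * O.var ^ (n + 1) =
        O.var * (O.var ^ n * O.incl a - O.incl a * O.var ^ n) + O.incl (δ a) * O.var ^ n := by
      rw [mul_sub, ← mul_assoc, ← mul_assoc, ← pow_succ', O.var_mul_incl, add_mul,
        mul_assoc _ O.var, ← pow_succ']
      abel
    rw [e]
    exact add_mem (hs _ ih) (Submodule.subset_span ⟨δ a, n, by omega, rfl⟩)

end OreExtension

/-! ### Hochschild cochains with values in the dual bimodule -/

/-- The Hochschild `n`-cochains of `E` with values in the `E`-bimodule `Hom_k(E, k)`. They are kept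
apart from the cyclic cochains `Cⁿ(E)`, with which `DualCochain.ofCyclic` identifies them, because
the recursions below peel off the first of the `n` arguments and leave the values alone. -/
def DualCochain (k E : Type*) [Field k] [Ring E] [Algebra k E] (n : ℕ) : Type _ :=
  MultilinearMap k (fun _ : Fin n => E) (E →ₗ[k] k)

namespace DualCochain

variable {k E : Type*} [Field k] [Ring E] [Algebra k E] {n : ℕ}

instance : AddCommGroup (DualCochain k E n) :=
  inferInstanceAs (AddCommGroup (MultilinearMap k (fun _ : Fin n => E) (E →ₗ[k] k)))

instance : Module k (DualCochain k E n) :=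
  inferInstanceAs (Module k (MultilinearMap k (fun _ : Fin n => E) (E →ₗ[k] k)))

instance : FunLike (DualCochain k E n) (Fin n → E) (E →ₗ[k] k) :=
  inferInstanceAs (FunLike (MultilinearMap k (fun _ : Fin n => E) (E →ₗ[k] k)) _ _)

@[ext]
theorem ext {f g : DualCochain k E n} (h : ∀ w c, f w c = g w c) : f = g :=
  MultilinearMap.ext fun w => LinearMap.ext (h w)

@[simp]
theorem add_apply (f g : DualCochain k E n) (w : Fin n → E) : (f + g) w = f w + g w := rfl

@[simp]
theorem sub_apply (f g : DualCochain k E n) (w : Fin n → E) : (f - g) w = f w - g w := rfl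

@[simp]
theorem smul_apply (a : k) (f : DualCochain k E n) (w : Fin n → E) : (a • f) w = a • f w := rfl

@[simp]
theorem zero_apply (w : Fin n → E) : (0 : DualCochain k E n) w = 0 := rfl

/-- Separation of the first argument of a cochain. -/
def curry : DualCochain k E (n + 1) ≃ₗ[k] (E →ₗ[k] DualCochain k E n) where
  toFun f :=
    { toFun := fun b => MultilinearMap.curryLeft f b
      map_add' := fun b c => LinearMap.map_add (MultilinearMap.curryLeft f) b c
      map_smul' := fun a b => LinearMap.map_smul (MultilinearMap.curryLeft f) a b }
  map_add' _ _ := rfl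
  map_smul' _ _ := rfl
  invFun g := LinearMap.uncurryLeft (M := fun _ : Fin (n + 1) => E)
    { toFun := fun b => g b
      map_add' := fun b c => g.map_add b c
      map_smul' := fun a b => g.map_smul a b }
  left_inv f := MultilinearMap.uncurry_curryLeft f
  right_inv _ := rfl

/-- Composition of the values of a cochain with a linear map. -/
def compValues (L : (E →ₗ[k] k) →ₗ[k] (E →ₗ[k] k)) : DualCochain k E n →ₗ[k] DualCochain k E n where
  toFun f := L.compMultilinearMap f
  map_add' f g := DualCochain.ext fun w c => LinearMap.congr_fun (map_add L (f w) (g w)) c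
  map_smul' a f := DualCochain.ext fun w c => LinearMap.congr_fun (map_smul L a (f w)) c

@[simp]
theorem compValues_apply (L : (E →ₗ[k] k) →ₗ[k] (E →ₗ[k] k)) (f : DualCochain k E n)
    (w : Fin n → E) : compValues L f w = L (f w) := rfl

theorem curry_apply (f : DualCochain k E (n + 1)) (b : E) (w : Fin n → E) :
    curry f b w = f (Fin.cons b w : Fin (n + 1) → E) := rfl

theorem apply_eq_curry (f : DualCochain k E (n + 1)) (w : Fin (n + 1) → E) :
    f w = curry f (w 0) (Fin.tail w) := by
  rw [curry_apply, Fin.cons_self_tail]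

theorem curry_ext {f g : DualCochain k E (n + 1)} (h : ∀ b, curry f b = curry g b) : f = g :=
  curry.injective (LinearMap.ext h)

/-- The left action of `E` on cochains, induced by `(b · m)(c) = m(c b)` on the values. -/
def lact : E →ₗ[k] DualCochain k E n →ₗ[k] DualCochain k E n :=
  LinearMap.mk₂ k (fun b f => compValues (LinearMap.lcomp k k (LinearMap.mulRight k b)) f)
    (fun b b' f => by ext; simp [mul_add]) (fun c b f => by ext; simp)
    (fun b f f' => by ext; simp) (fun c b f => by ext; simp)

/-- The right action of `E` on cochains, induced by `(m · b)(c) = m(b c)` on the values. -/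
def ract : E →ₗ[k] DualCochain k E n →ₗ[k] DualCochain k E n :=
  LinearMap.mk₂ k (fun b f => compValues (LinearMap.lcomp k k (LinearMap.mulLeft k b)) f)
    (fun b b' f => by ext; simp [add_mul]) (fun c b f => by ext; simp)
    (fun b f f' => by ext; simp) (fun c b f => by ext; simp)

theorem lact_apply (b : E) (f : DualCochain k E n) (w : Fin n → E) (c : E) :
    lact b f w c = f w (c * b) := rfl

theorem ract_apply (b : E) (f : DualCochain k E n) (w : Fin n → E) (c : E) :
    ract b f w c = f w (b * c) := rfl

@[simp]
theorem lact_one (f : DualCochain k E n) : lact 1 f = f := by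
  ext; simp [lact_apply]

theorem lact_mul (b c : E) (f : DualCochain k E n) : lact (b * c) f = lact b (lact c f) := by
  ext; simp [lact_apply, mul_assoc]

theorem ract_mul (b c : E) (f : DualCochain k E n) : ract (b * c) f = ract c (ract b f) := by
  ext; simp [ract_apply, mul_assoc]

theorem ract_lact (b c : E) (f : DualCochain k E n) : ract b (lact c f) = lact c (ract b f) := by
  ext; simp [ract_apply, lact_apply, mul_assoc]

@[simp]
theorem curry_lact (b c : E) (f : DualCochain k E (n + 1)) :
    curry (lact b f) c = lact b (curry f c) := rfl

/-- The part of the Hochschild coboundary in which the first argument is not moved to the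
coefficients: `(d f)(b₁, …, bₙ₊₁) = f(b₁ b₂, b₃, …) - f(b₁, b₂ b₃, …) + … ± f(b₁, …, bₙ) · bₙ₊₁`. -/
def d : (n : ℕ) → DualCochain k E n →ₗ[k] DualCochain k E (n + 1)
  | 0 => curry.symm.toLinearMap ∘ₗ ract.flip
  | n + 1 => curry.symm.toLinearMap ∘ₗ LinearMap.mk₂ k
      (fun f b => curry.symm (curry f ∘ₗ LinearMap.mulLeft k b) - d n (curry f b))
      (fun f f' b => by simp only [map_add, LinearMap.add_comp, LinearMap.add_apply]; abel)
      (fun c f b => by simp only [map_smul, LinearMap.smul_comp, LinearMap.smul_apply, smul_sub])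
      (fun f b b' => by
        have : LinearMap.mulLeft k (b + b') = LinearMap.mulLeft k b + LinearMap.mulLeft k b' := by
          ext; simp [add_mul]
        rw [this, LinearMap.comp_add]; simp only [map_add]; abel)
      (fun c f b => by
        have : LinearMap.mulLeft k (c • b) = c • LinearMap.mulLeft k b := by
          ext; simp
        rw [this, LinearMap.comp_smul]; simp only [map_smul, smul_sub])

@[simp]
theorem curry_d_zero (f : DualCochain k E 0) (b : E) : curry (d 0 f) b = ract b f := by
  simp [d]

theorem curry_d_eq (f : DualCochain k E (n + 1)) (b : E) :
    curry (d (n + 1) f) b = curry.symm (curry f ∘ₗ LinearMap.mulLeft k b) - d n (curry f b) := by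
  simp [d]

@[simp]
theorem curry_curry_d (f : DualCochain k E (n + 1)) (b c : E) :
    curry (curry (d (n + 1) f) b) c = curry f (b * c) - curry (d n (curry f b)) c := by
  simp [d]

/-- The part of the Hochschild coboundary in which the first argument acts on the coefficients. -/
def mu : DualCochain k E n →ₗ[k] DualCochain k E (n + 1) :=
  curry.symm.toLinearMap ∘ₗ lact.flip

@[simp]
theorem curry_mu (f : DualCochain k E n) (b : E) : curry (mu f) b = lact b f := by
  simp [mu]

/-- The Hochschild coboundary with coefficients in `Hom_k(E, k)`. -/
def coboundary (n : ℕ) : DualCochain k E n →ₗ[k] DualCochain k E (n + 1) := mu - d n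

theorem coboundary_apply (f : DualCochain k E n) : coboundary n f = mu f - d n f := rfl

theorem d_lact (b : E) : ∀ {n : ℕ} (f : DualCochain k E n), d n (lact b f) = lact b (d n f)
  | 0, f => curry_ext fun c => by simp [ract_lact]
  | n + 1, f => curry_ext fun c => curry_ext fun c' => by simp [d_lact b (curry f c)]

/-- The two parts of the coboundary interact so that `d² = 0` gives `(μ - d)² = 0`. -/
theorem d_mu (f : DualCochain k E n) : d (n + 1) (mu f) = mu (coboundary n f) :=
  curry_ext fun b => curry_ext fun c => by
    simp [coboundary_apply, lact_mul, d_lact, map_sub]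

theorem d_d : ∀ {n : ℕ} (f : DualCochain k E n), d (n + 1) (d n f) = 0
  | 0, f => curry_ext fun b => curry_ext fun c => by simp [ract_mul]
  | n + 1, f => curry_ext fun b => curry_ext fun c => by
    have h : d (n + 1) (curry (d (n + 1) f) b) =
        d (n + 1) (curry.symm (curry f ∘ₗ LinearMap.mulLeft k b)) := by
      rw [curry_d_eq, map_sub, d_d, sub_zero]
    rw [curry_curry_d, h]
    refine curry_ext fun c' => ?_
    simp [mul_assoc]

theorem coboundary_coboundary (f : DualCochain k E n) :
    coboundary (n + 1) (coboundary n f) = 0 := by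
  rw [coboundary_apply (coboundary n f), ← d_mu, coboundary_apply f, map_sub, d_d]
  simp

end DualCochain

/-! ### Restriction of cochains to the coefficients and the prism homotopy -/

namespace OreExtension

open DualCochain

variable {k A E : Type*} [Field k] [Ring A] [Algebra k A] {δ : A →ₗ[k] A} [Ring E] [Algebra k E]
  (O : OreExtension δ E) {P : Type*} [AddCommGroup P] [Module k P]

/-- The cochain `(b₁, …, bₙ) ↦ ∑ f(a₁, …, aₙ) · x^{lₙ}` determined by the values of `f` on words in
`A`. The monomials come from moving powers of `x` to the right: `xˡ b₁ = ∑ a₁ x^{l₁}`, then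
`x^{l₁} b₂ = ∑ a₂ x^{l₂}`, and so on. -/
def row : (n l : ℕ) → DualCochain k E n →ₗ[k] DualCochain k E n
  | 0, l => ract (O.var ^ l)
  | n + 1, l => curry.symm.toLinearMap ∘ₗ
    { toFun := fun f =>
        O.lift (fun m => row n m ∘ₗ curry f ∘ₗ O.incl.toLinearMap) ∘ₗ
          LinearMap.mulLeft k (O.var ^ l)
      map_add' := fun f g => by
        simp only [map_add, LinearMap.add_comp, LinearMap.comp_add, lift_add]
      map_smul' := fun a f => by
        simp only [map_smul, LinearMap.smul_comp, LinearMap.comp_smul, lift_smul,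
          RingHom.id_apply] }

@[simp]
theorem row_zero (l : ℕ) (f : DualCochain k E 0) : O.row 0 l f = ract (O.var ^ l) f := rfl

@[simp]
theorem curry_row (n l : ℕ) (f : DualCochain k E (n + 1)) (b : E) :
    curry (O.row (n + 1) l f) b =
      O.lift (fun m => O.row n m ∘ₗ curry f ∘ₗ O.incl.toLinearMap) (O.var ^ l * b) := by
  simp [row]

/-- The homotopy `∑ᵢ ± f(a₁, …, aᵢ, x^{lᵢ}, bᵢ₊₁, …, bₙ)`, with `aᵢ` and `lᵢ` as in
`OreExtension.row`. By `OreExtension.prism_d` and `coboundary = mu - d`, it is a homotopy between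
the left action of `xˡ` and `OreExtension.row`. -/
def prism : (n l : ℕ) → DualCochain k E (n + 1) →ₗ[k] DualCochain k E n
  | 0, l => LinearMap.applyₗ (O.var ^ l) ∘ₗ curry.toLinearMap
  | n + 1, l => curry.symm.toLinearMap ∘ₗ
    { toFun := fun f => curry (curry f (O.var ^ l)) -
        O.lift (fun m => prism n m ∘ₗ curry f ∘ₗ O.incl.toLinearMap) ∘ₗ
          LinearMap.mulLeft k (O.var ^ l)
      map_add' := fun f g => by
        simp only [map_add, LinearMap.add_comp, LinearMap.comp_add, lift_add, LinearMap.add_apply]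
        abel
      map_smul' := fun a f => by
        simp only [map_smul, LinearMap.smul_comp, LinearMap.comp_smul, lift_smul, RingHom.id_apply,
          LinearMap.smul_apply, smul_sub] }

@[simp]
theorem prism_zero (l : ℕ) (f : DualCochain k E 1) : O.prism 0 l f = curry f (O.var ^ l) := by
  simp [prism]

@[simp]
theorem curry_prism (n l : ℕ) (f : DualCochain k E (n + 2)) (b : E) :
    curry (O.prism (n + 1) l f) b = curry (curry f (O.var ^ l)) b -
      O.lift (fun m => O.prism n m ∘ₗ curry f ∘ₗ O.incl.toLinearMap) (O.var ^ l * b) := by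
  simp [prism]

theorem lift_incl_mul (h : ℕ → A →ₗ[k] P) (a : A) (e : E) :
    O.lift h (O.incl a * e) = O.lift (fun m => h m ∘ₗ LinearMap.mulLeft k a) e := by
  induction e using O.induction with
  | zero => simp
  | add u v hu hv => simp only [mul_add, map_add, hu, hv]
  | mon b m =>
    rw [← mul_assoc, ← map_mul, lift_monomial, lift_monomial]
    simp

theorem mulLeft_comp_incl (a : A) : O.incl.toLinearMap ∘ₗ LinearMap.mulLeft k a =
    LinearMap.mulLeft k (O.incl a) ∘ₗ O.incl.toLinearMap := by
  ext; simp

theorem prism_lact (b : E) : ∀ (n l : ℕ) (f : DualCochain k E (n + 1)),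
    O.prism n l (lact b f) = lact b (O.prism n l f)
  | 0, l, f => by simp
  | n + 1, l, f => curry_ext fun c => by
    simp only [curry_prism, curry_lact, map_lift, map_sub]
    congr 3
    ext m a : 2
    simp [prism_lact b n m]

/-- The prism formula. Only the terms `f(a₁, …, aₙ) · x^{lₙ}` survive, all others cancel. -/
theorem prism_d : ∀ (n l : ℕ) (f : DualCochain k E (n + 1)),
    O.prism (n + 1) l (d (n + 1) f) + d n (O.prism n l f) = O.row (n + 1) l f
  | 0, l, f => curry_ext fun b => by
    have h : ∀ e, O.lift (fun m => O.prism 0 m ∘ₗ curry (d 1 f) ∘ₗ O.incl.toLinearMap) e =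
        curry f e - O.lift (fun m => O.row 0 m ∘ₗ curry f ∘ₗ O.incl.toLinearMap) e := by
      intro e
      rw [← LinearMap.sub_apply]
      refine LinearMap.congr_fun (O.hom_ext fun a m => ?_) e
      simp
    simp only [map_add, LinearMap.add_apply, curry_prism, h, curry_row, curry_curry_d,
      curry_d_zero, prism_zero]
    abel
  | n + 1, l, f => curry_ext fun b => curry_ext fun c => by
    have h : ∀ e, curry (O.lift (fun m => O.prism (n + 1) m ∘ₗ curry (d (n + 2) f) ∘ₗ
        O.incl.toLinearMap) e) c =
        curry (curry f e) c -
          O.lift (fun m => O.prism n m ∘ₗ curry f ∘ₗ O.incl.toLinearMap) (e * c) -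
        curry (O.lift (fun m => O.row (n + 1) m ∘ₗ curry f ∘ₗ O.incl.toLinearMap) e) c +
        curry (d n (O.lift (fun m => O.prism n m ∘ₗ curry f ∘ₗ O.incl.toLinearMap) e)) c := by
      intro e
      induction e using O.induction with
      | zero => simp
      | add u v hu hv =>
        simp only [map_add, LinearMap.add_apply, add_mul, hu, hv]
        abel
      | mon a m =>
        simp only [lift_monomial, LinearMap.comp_apply, AlgHom.toLinearMap_apply, curry_d_eq]
        rw [mul_assoc (O.incl a) (O.var ^ m) c, lift_incl_mul, map_sub,
          eq_sub_of_add_eq (prism_d n m (curry f (O.incl a)))]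
        simp only [map_sub, LinearMap.sub_apply, curry_prism, LinearEquiv.apply_symm_apply,
          LinearMap.comp_apply, LinearMap.mulLeft_apply, ← O.mulLeft_comp_incl,
          LinearMap.comp_assoc]
        abel
    simp only [map_add, LinearMap.add_apply, curry_prism, map_sub, LinearMap.sub_apply, h,
      curry_row, curry_curry_d, mul_assoc]
    abel

end OreExtension

/-! ### Comparison of the cochains of `E` with left `A`-linear cochains -/

namespace OreExtension

open DualCochain

variable {k A E : Type*} [Field k] [Ring A] [Algebra k A] {δ : A →ₗ[k] A} [Ring E] [Algebra k E]
  (O : OreExtension δ E) {n : ℕ}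

/-- Left `A`-linearity in the first argument. For a cochain `f`, regarded as a function of its first
argument through `curry`, this says that `f` is a cochain on the resolution `E ⊗_A Bar(E)`; with
the differential `DualCochain.d`, such cochains compute the Hochschild cohomology of `A` with values
in `Hom_k(E, k)`. -/
def Balanced (g : E →ₗ[k] DualCochain k E n) : Prop :=
  ∀ a u, g (O.incl a * u) = lact (O.incl a) (g u)

/-- The left `A`-linear map with value `h l` at `xˡ`. -/
def leftLinear (h : ℕ → DualCochain k E n) : E →ₗ[k] DualCochain k E n :=
  O.lift fun l => lact.flip (h l) ∘ₗ O.incl.toLinearMap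

@[simp]
theorem leftLinear_monomial (h : ℕ → DualCochain k E n) (a : A) (l : ℕ) :
    O.leftLinear h (O.incl a * O.var ^ l) = lact (O.incl a) (h l) := by
  simp [leftLinear]

@[simp]
theorem leftLinear_var_pow (h : ℕ → DualCochain k E n) (l : ℕ) :
    O.leftLinear h (O.var ^ l) = h l := by
  simpa using O.leftLinear_monomial h 1 l

@[simp]
theorem leftLinear_one (h : ℕ → DualCochain k E n) : O.leftLinear h 1 = h 0 := by
  simpa using O.leftLinear_monomial h 1 0

theorem leftLinear_balanced (h : ℕ → DualCochain k E n) : O.Balanced (O.leftLinear h) := by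
  intro a u
  induction u using O.induction with
  | zero => simp
  | add u v hu hv => simp only [mul_add, map_add, hu, hv]
  | mon b m =>
    rw [← mul_assoc, ← map_mul, leftLinear_monomial, leftLinear_monomial, map_mul, lact_mul]

/-- The left `A`-linear cochain with value `prism l f` at `xˡ`. -/
def homotopy (f : DualCochain k E (n + 1)) : DualCochain k E (n + 1) :=
  curry.symm (O.leftLinear fun l => O.prism n l f)

/-- The left `A`-linear cochain with value `row l f` at `xˡ`. It depends only on the values of `f`
on words in `A`. -/
def extend : DualCochain k E n →ₗ[k] DualCochain k E (n + 1) where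
  toFun f := curry.symm (O.leftLinear fun l => O.row n l f)
  map_add' f g := by
    rw [← map_add]; congr 1
    exact O.hom_ext fun a m => by simp
  map_smul' c f := by
    rw [RingHom.id_apply, ← map_smul]; congr 1
    exact O.hom_ext fun a m => by simp

@[simp]
theorem curry_homotopy (f : DualCochain k E (n + 1)) :
    curry (O.homotopy f) = O.leftLinear fun l => O.prism n l f := by
  simp [homotopy]

@[simp]
theorem curry_extend (f : DualCochain k E n) :
    curry (O.extend f) = O.leftLinear fun l => O.row n l f := by
  simp [extend]

theorem homotopy_zero : O.homotopy (0 : DualCochain k E (n + 1)) = 0 := by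
  refine curry.injective (O.hom_ext fun a m => ?_)
  simp

theorem homotopy_coboundary_zero (f : DualCochain k E 0) :
    O.homotopy (coboundary 0 f) = mu f - O.extend f := by
  refine curry.injective (O.hom_ext fun a l => ?_)
  simp [coboundary_apply, lact_mul]

/-- `extend` is homotopic to `mu`, the inclusion of the cochains of `E` into the left `A`-linear
cochains. -/
theorem homotopy_coboundary (f : DualCochain k E (n + 1)) :
    O.homotopy (coboundary (n + 1) f) + d (n + 1) (O.homotopy f) = mu f - O.extend f := by
  refine curry.injective (O.hom_ext fun a l => curry_ext fun b => ?_)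
  have h1 : ∀ e, O.lift (fun m => O.prism n m ∘ₗ curry (mu f) ∘ₗ O.incl.toLinearMap) e =
      O.leftLinear (fun l => O.prism n l f) e := by
    intro e
    refine LinearMap.congr_fun (O.hom_ext fun a m => ?_) e
    simp [prism_lact]
  have h2 := congrArg (lact (O.incl a)) (LinearMap.congr_fun
    (congrArg curry (O.prism_d n l f)) b)
  simp only [map_add, LinearMap.add_apply] at h2
  simp only [map_add, LinearMap.add_apply, curry_homotopy, leftLinear_var_pow, coboundary_apply,
    map_sub, LinearMap.sub_apply, curry_prism, h1, curry_extend, curry_curry_d, curry_mu,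
    mul_assoc, lact_mul, curry_lact, d_lact, (O.leftLinear_balanced _) a, ← h2]
  abel

theorem d_extend (f : DualCochain k E n) : d (n + 1) (O.extend f) = O.extend (coboundary n f) := by
  have h1 := O.homotopy_coboundary (coboundary n f)
  rw [coboundary_coboundary, homotopy_zero, zero_add] at h1
  cases n with
  | zero =>
    rw [homotopy_coboundary_zero, map_sub, d_mu] at h1
    exact sub_right_injective h1
  | succ n =>
    rw [eq_sub_of_add_eq (O.homotopy_coboundary f), map_sub, d_d, sub_zero, map_sub, d_mu] at h1
    exact sub_right_injective h1

/-! ### Contraction along the noncommutative differential of the variable -/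

/-- Contraction along the Fox differential `d(a xᵐ) = ∑ a x^{m-1-l} dx xˡ`: the value at `a xᵐ` is
`∑ a x^{m-1-l} · g(xˡ)`. -/
def fox : (E →ₗ[k] DualCochain k E n) →ₗ[k] E →ₗ[k] DualCochain k E n where
  toFun g := O.lift fun m => ∑ l ∈ Finset.range m,
    lact.flip (g (O.var ^ l)) ∘ₗ LinearMap.mulRight k (O.var ^ (m - 1 - l)) ∘ₗ O.incl.toLinearMap
  map_add' f g := O.hom_ext fun a m => by simp [LinearMap.sum_apply, Finset.sum_add_distrib]
  map_smul' c f := O.hom_ext fun a m => by simp [LinearMap.sum_apply, Finset.smul_sum]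

theorem fox_monomial (g : E →ₗ[k] DualCochain k E n) (a : A) (m : ℕ) :
    O.fox g (O.incl a * O.var ^ m) =
      ∑ l ∈ Finset.range m, lact (O.incl a * O.var ^ (m - 1 - l)) (g (O.var ^ l)) := by
  simp [fox, LinearMap.sum_apply]

@[simp]
theorem fox_incl (g : E →ₗ[k] DualCochain k E n) (a : A) : O.fox g (O.incl a) = 0 := by
  simpa using O.fox_monomial g a 0

theorem fox_mul_var (g : E →ₗ[k] DualCochain k E n) (e : E) :
    O.fox g (e * O.var) = lact e (g 1) + O.fox (g ∘ₗ LinearMap.mulRight k O.var) e := by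
  induction e using O.induction with
  | zero => simp
  | add u v hu hv => simp only [add_mul, map_add, LinearMap.add_apply, hu, hv]; abel
  | mon a m =>
    rw [mul_assoc, ← pow_succ, fox_monomial, fox_monomial, Finset.sum_range_succ', add_comm]
    simp only [pow_zero, Nat.sub_zero, Nat.add_sub_cancel, LinearMap.comp_apply,
      LinearMap.mulRight_apply, ← pow_succ, Nat.sub_sub, Nat.add_comm 1]

variable {O}

theorem Balanced.comp_mulRight {g : E →ₗ[k] DualCochain k E n} (hg : O.Balanced g) (e : E) :
    O.Balanced (g ∘ₗ LinearMap.mulRight k e) := fun a u => by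
  simp [mul_assoc, hg a]

theorem Balanced.fox_mul_incl {g : E →ₗ[k] DualCochain k E n} (hg : O.Balanced g) (e : E) (a : A) :
    O.fox g (e * O.incl a) = O.fox (g ∘ₗ LinearMap.mulRight k (O.incl a)) e := by
  induction e using O.induction with
  | zero => simp
  | add u v hu hv => simp only [add_mul, map_add, hu, hv]
  | mon b m =>
    induction m generalizing a g with
    | zero => simp [← map_mul]
    | succ m ih =>
      have e1 : O.incl b * O.var ^ (m + 1) * O.incl a =
          O.incl b * O.var ^ m * O.incl a * O.var + O.incl b * O.var ^ m * O.incl (δ a) := by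
        rw [pow_succ]
        simp only [mul_assoc, O.var_mul_incl, mul_add]
      have e2 : (g ∘ₗ LinearMap.mulRight k (O.incl a)) ∘ₗ LinearMap.mulRight k O.var =
          (g ∘ₗ LinearMap.mulRight k O.var) ∘ₗ LinearMap.mulRight k (O.incl a) +
            g ∘ₗ LinearMap.mulRight k (O.incl (δ a)) := by
        ext1 u
        simp [mul_assoc, O.var_mul_incl, mul_add]
      have e3 : g (O.incl a) = lact (O.incl a) (g 1) := by simpa using hg a 1
      rw [e1, map_add, fox_mul_var, ih hg, ih (hg.comp_mulRight _), pow_succ, ← mul_assoc,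
        fox_mul_var, e2, map_add, lact_mul _ (O.incl a), ← e3]
      simp [add_assoc]

/-- The Leibniz rule for the Fox differential. -/
theorem Balanced.fox_mul {g : E →ₗ[k] DualCochain k E n} (hg : O.Balanced g) (e e' : E) :
    O.fox g (e * e') = lact e (O.fox g e') + O.fox (g ∘ₗ LinearMap.mulRight k e') e := by
  induction e' using O.induction with
  | zero =>
    have : LinearMap.mulRight k (0 : E) = 0 := by ext; simp
    simp [this]
  | add u v hu hv =>
    have : LinearMap.mulRight k (u + v) = LinearMap.mulRight k u + LinearMap.mulRight k v := by
      ext; simp [mul_add]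
    rw [this, LinearMap.comp_add, mul_add, map_add, map_add, map_add, map_add, hu, hv,
      LinearMap.add_apply]
    abel
  | mon a m =>
    induction m generalizing g with
    | zero => simp [hg.fox_mul_incl]
    | succ m ih =>
      have e2 : (g ∘ₗ LinearMap.mulRight k O.var) ∘ₗ LinearMap.mulRight k (O.incl a * O.var ^ m) =
          g ∘ₗ LinearMap.mulRight k (O.incl a * O.var ^ (m + 1)) := by
        ext1 u
        simp [mul_assoc, pow_succ]
      rw [← e2, pow_succ, ← mul_assoc (O.incl a), ← mul_assoc e, fox_mul_var,
        ih (hg.comp_mulRight _), fox_mul_var, map_add, lact_mul, add_assoc]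

variable (O)

/-- `fox` applied to the first argument. On left `A`-linear cochains it represents the connecting
homomorphism of the exact sequence `0 → E ⊗_A E → E ⊗_A E → E → 0` of bimodules. -/
def contract : DualCochain k E (n + 1) →ₗ[k] DualCochain k E (n + 1) :=
  curry.symm.toLinearMap ∘ₗ O.fox ∘ₗ curry.toLinearMap

@[simp]
theorem curry_contract (f : DualCochain k E (n + 1)) :
    curry (O.contract f) = O.fox (curry f) := by
  simp [contract]

theorem coboundary_contract {f : DualCochain k E (n + 1)} (hf : O.Balanced (curry f)) :
    coboundary (n + 1) (O.contract f) = - O.contract (d (n + 1) f) := by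
  refine curry_ext fun e => curry_ext fun b => ?_
  have h : curry (O.fox (curry (d (n + 1) f)) e) b =
      O.fox (curry f ∘ₗ LinearMap.mulRight k b) e - curry (d n (O.fox (curry f) e)) b := by
    induction e using O.induction with
    | zero => simp
    | add u v hu hv => simp only [map_add, LinearMap.add_apply, hu, hv]; abel
    | mon a m =>
      simp only [fox_monomial, map_sum, LinearMap.sum_apply, ← Finset.sum_sub_distrib]
      refine Finset.sum_congr rfl fun l _ => ?_
      simp [d_lact]
  simp only [coboundary_apply, map_sub, LinearMap.sub_apply, curry_mu, curry_lact, curry_contract,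
    curry_curry_d, hf.fox_mul, map_neg, LinearMap.neg_apply, h]
  abel

/-- The commutator with the variable, which represents the action of `[x, ·]` on the cohomology of
the left `A`-linear cochains. -/
def commVar (f : DualCochain k E (n + 1)) : DualCochain k E (n + 1) :=
  curry.symm (curry f ∘ₗ LinearMap.mulLeft k O.var - lact O.var ∘ₗ curry f)

@[simp]
theorem curry_commVar (f : DualCochain k E (n + 1)) (u : E) :
    curry (O.commVar f) u = curry f (O.var * u) - lact O.var (curry f u) := by
  simp [commVar]

theorem balanced_commVar {f : DualCochain k E (n + 1)} (hf : O.Balanced (curry f)) :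
    O.Balanced (curry (O.commVar f)) := by
  intro a u
  rw [curry_commVar, curry_commVar, ← mul_assoc, O.var_mul_incl, add_mul, map_add, mul_assoc,
    hf, hf, hf, ← lact_mul, O.var_mul_incl, map_sub, map_add, LinearMap.add_apply, ← lact_mul]
  abel

theorem d_commVar (f : DualCochain k E (n + 1)) :
    d (n + 1) (O.commVar f) = O.commVar (d (n + 1) f) := by
  refine curry_ext fun e => curry_ext fun b => ?_
  simp [mul_assoc, d_lact]
  abel

theorem commVar_mu (f : DualCochain k E n) : O.commVar (mu f) = 0 :=
  curry_ext fun e => by simp [lact_mul]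

/-- The differences `x^{m-l} · f(xˡ) - x^{m-l-1} · f(x^{l+1})` telescope. -/
theorem curry_contract_commVar {f : DualCochain k E (n + 1)} (hf : O.Balanced (curry f)) (e : E) :
    curry (O.contract (O.commVar f)) e = curry f e - lact e (curry f 1) := by
  rw [curry_contract]
  induction e using O.induction with
  | zero => simp
  | add u v hu hv => simp only [map_add, LinearMap.add_apply, hu, hv]; abel
  | mon a m =>
    rw [fox_monomial, hf a, lact_mul, ← map_sub]
    simp only [lact_mul, ← map_sum]
    congr 1
    have := Finset.sum_range_sub (fun l => lact (O.var ^ (m - l)) (curry f (O.var ^ l))) m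
    simp only [Nat.sub_self, pow_zero, lact_one, Nat.sub_zero] at this
    rw [← this]
    refine Finset.sum_congr rfl fun l hl => ?_
    have h1 : m - l = m - 1 - l + 1 := by have := Finset.mem_range.1 hl; omega
    have h2 : m - (l + 1) = m - 1 - l := by omega
    rw [curry_commVar, map_sub, ← pow_succ', h1, h2, pow_succ O.var (m - 1 - l), lact_mul]

theorem coboundary_curry_one (f : DualCochain k E (n + 1)) (b : E) :
    curry (coboundary n (curry f 1)) b =
      curry (curry (d (n + 1) f) 1) b - (curry f b - lact b (curry f 1)) := by
  simp [coboundary_apply]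

end OreExtension

/-! ### Identification with the cyclic cochains -/

namespace DualCochain

variable {k E : Type*} [Field k] [Ring E] [Algebra k E] {n : ℕ}

/-- The cochain `φ(a₀, …, aₙ)`, as an `n`-cochain with values in `Hom_k(E, k)`, the argument `a₀`
being that of the values. -/
def ofCyclic : CyclicCochain k E n ≃ₗ[k] DualCochain k E n where
  toFun f := MultilinearMap.mk'
    (fun w =>
      { toFun := fun c => f (Fin.cons c w : Fin (n + 1) → E)
        map_add' := fun c c' => MultilinearMap.cons_add f w c c'
        map_smul' := fun a c => MultilinearMap.cons_smul f w a c })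
    (fun w i x y => by ext c; simp [Fin.cons_update])
    (fun w i a x => by ext c; simp [Fin.cons_update])
  map_add' _ _ := rfl
  map_smul' _ _ := rfl
  invFun g := MultilinearMap.mk' (fun v => g (Fin.tail v) (v 0))
    (fun v i x y => by
      cases i using Fin.cases with
      | zero => simp
      | succ i =>
        simp only [Fin.tail_update_succ, ne_eq, Fin.succ_ne_zero, not_false_eq_true, Ne.symm,
          Function.update_of_ne]
        exact LinearMap.congr_fun (MultilinearMap.map_update_add g (Fin.tail v) i x y) _)
    (fun v i a x => by
      cases i using Fin.cases with
      | zero => simp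
      | succ i =>
        simp only [Fin.tail_update_succ, ne_eq, Fin.succ_ne_zero, not_false_eq_true, Ne.symm,
          Function.update_of_ne]
        exact LinearMap.congr_fun (MultilinearMap.map_update_smul g (Fin.tail v) i a x) _)
  left_inv f := MultilinearMap.ext fun v => congrArg f (Fin.cons_self_tail v)
  right_inv _ := rfl

theorem ofCyclic_apply (f : CyclicCochain k E n) (w : Fin n → E) (c : E) :
    ofCyclic f w c = f (Fin.cons c w : Fin (n + 1) → E) := rfl

theorem contractNth_zero (w : Fin (n + 2) → E) :
    Fin.contractNth 0 (· * ·) w = Fin.cons (w 0 * w 1) (Fin.tail (Fin.tail w)) := by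
  funext j
  cases j using Fin.cases with
  | zero => simp [Fin.contractNth]
  | succ j => simp [Fin.contractNth, Fin.tail]

theorem contractNth_succ (i : Fin (n + 1)) (w : Fin (n + 2) → E) :
    Fin.contractNth i.succ (· * ·) w = Fin.cons (w 0) (Fin.contractNth i (· * ·) (Fin.tail w)) := by
  funext j
  cases j using Fin.cases with
  | zero => simp [Fin.contractNth]
  | succ j => simp [Fin.contractNth, Fin.tail]

theorem d_apply : ∀ {n : ℕ} (f : DualCochain k E n) (w : Fin (n + 1) → E) (c : E),
    d n f w c = ∑ i : Fin n, (-1 : k) ^ (i : ℕ) * f (Fin.contractNth i.castSucc (· * ·) w) c +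
      (-1 : k) ^ n * f (Fin.init w) (w (Fin.last n) * c)
  | 0, f, w, c => by
    rw [apply_eq_curry, curry_d_zero, ract_apply]
    simp only [Finset.univ_eq_empty, Finset.sum_empty, pow_zero, one_mul, zero_add]
    rw [Subsingleton.elim (Fin.tail w) (Fin.init w)]
    rfl
  | n + 1, f, w, c => by
    rw [apply_eq_curry, curry_d_eq, sub_apply, LinearMap.sub_apply, d_apply (curry f (w 0)),
      Fin.sum_univ_succ, apply_eq_curry (curry.symm _)]
    simp only [LinearEquiv.apply_symm_apply, LinearMap.comp_apply, LinearMap.mulLeft_apply,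
      curry_apply, Fin.castSucc_zero, contractNth_zero, Fin.val_zero, pow_zero, one_mul,
      ← Fin.succ_castSucc, contractNth_succ, Fin.val_succ, pow_succ]
    have : Fin.init w = Fin.cons (w 0) (Fin.init (Fin.tail w)) := by
      funext j
      cases j using Fin.cases <;> simp [Fin.init, Fin.tail]
    rw [this]
    simp only [mul_neg, mul_one, neg_mul, Finset.sum_neg_distrib, Fin.tail, Fin.succ_zero_eq_one,
      Fin.succ_last]
    ring

theorem succ_sub_one (j : Fin (n + 1)) : (j.succ - 1 : Fin (n + 2)) = j.castSucc :=
  sub_eq_iff_eq_add.2 Fin.coeSucc_eq_succ.symm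

theorem zero_sub_one : (0 - 1 : Fin (n + 2)) = Fin.last (n + 1) :=
  sub_eq_iff_eq_add.2 (Fin.last_add_one _).symm

theorem ofCyclic_b (f : CyclicCochain k E n) :
    ofCyclic (CyclicCochain.b n f) = coboundary n (ofCyclic f) := by
  ext w c
  rw [coboundary_apply, sub_apply, LinearMap.sub_apply, d_apply, apply_eq_curry (mu _), curry_mu,
    lact_apply, ofCyclic_apply]
  simp only [CyclicCochain.b, LinearMap.add_apply, LinearMap.sum_apply, LinearMap.smul_apply,
    _root_.add_apply, _root_.sum_apply, _root_.smul_apply,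
    LinearMap.comp_apply, CyclicCochain.face_apply, CyclicCochain.cyc_apply, smul_eq_mul]
  rw [Fin.sum_univ_succ]
  have h : Fin.contractNth (Fin.castSucc 0) (· * ·)
      (fun i => (Fin.cons c w : Fin (n + 2) → E) (i - 1)) =
      Fin.cons (w (Fin.last n) * c) (Fin.init w) := by
    rw [Fin.castSucc_zero, contractNth_zero, zero_sub_one, sub_self]
    congr 1
    funext j
    simp only [Fin.tail]
    rw [succ_sub_one, ← Fin.succ_castSucc, Fin.cons_succ]
    rfl
  rw [h]
  simp only [Fin.castSucc_zero, contractNth_zero, Fin.val_zero, pow_zero, one_mul,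
      ← Fin.succ_castSucc, contractNth_succ, Fin.val_succ, pow_succ, ofCyclic_apply, Fin.cons_zero,
      Fin.tail_cons, Fin.cons_one, mul_neg, mul_one, neg_mul, Finset.sum_neg_distrib]
  ring

end DualCochain

/-! ### Transgression, and Hochschild cocycles that vanish on words in `A` -/

namespace OreExtension

open DualCochain

variable {k A E : Type*} [Field k] [Ring A] [Algebra k A] {δ : A →ₗ[k] A} [Ring E] [Algebra k E]
  (O : OreExtension δ E) {n : ℕ}

/-- The cochain vanishes when all its arguments, other than that of the values, lie in `A`. -/
def VanishesOnBase (f : DualCochain k E n) : Prop := ∀ w : Fin n → A, f (O.incl ∘ w) = 0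

variable {O}

theorem cons_comp (a : A) (w : Fin n → A) :
    O.incl ∘ (Fin.cons a w : Fin (n + 1) → A) = Fin.cons (O.incl a) (O.incl ∘ w) := by
  funext j
  cases j using Fin.cases <;> simp

theorem vanishesOnBase_succ {f : DualCochain k E (n + 1)} :
    O.VanishesOnBase f ↔ ∀ a, O.VanishesOnBase (curry f (O.incl a)) := by
  refine ⟨fun h a w => ?_, fun h w => ?_⟩
  · rw [curry_apply, ← cons_comp]
    exact h _
  · rw [apply_eq_curry]
    exact h (w 0) (Fin.tail w)

theorem VanishesOnBase.add {f g : DualCochain k E n} (hf : O.VanishesOnBase f)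
    (hg : O.VanishesOnBase g) : O.VanishesOnBase (f + g) := fun w => by
  rw [DualCochain.add_apply, hf, hg, add_zero]

theorem VanishesOnBase.sub {f g : DualCochain k E n} (hf : O.VanishesOnBase f)
    (hg : O.VanishesOnBase g) : O.VanishesOnBase (f - g) := fun w => by
  rw [DualCochain.sub_apply, hf, hg, sub_zero]

theorem VanishesOnBase.lact {f : DualCochain k E n} (hf : O.VanishesOnBase f) (b : E) :
    O.VanishesOnBase (lact b f) := fun w => by
  ext c
  rw [lact_apply, hf]
  rfl

theorem VanishesOnBase.ract {f : DualCochain k E n} (hf : O.VanishesOnBase f) (b : E) :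
    O.VanishesOnBase (ract b f) := fun w => by
  ext c
  rw [ract_apply, hf]
  rfl

theorem VanishesOnBase.d : ∀ {n : ℕ} {f : DualCochain k E n}, O.VanishesOnBase f →
    O.VanishesOnBase (d n f)
  | 0, f, hf => vanishesOnBase_succ.2 fun a => by
    rw [curry_d_zero]; exact hf.ract _
  | n + 1, f, hf => vanishesOnBase_succ.2 fun a => by
    rw [vanishesOnBase_succ] at hf
    rw [curry_d_eq]
    refine VanishesOnBase.sub (vanishesOnBase_succ.2 fun a' => ?_) (VanishesOnBase.d (hf a))
    rw [LinearEquiv.apply_symm_apply, LinearMap.comp_apply, LinearMap.mulLeft_apply, ← map_mul]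
    exact hf _

theorem VanishesOnBase.coboundary {f : DualCochain k E n} (hf : O.VanishesOnBase f) :
    O.VanishesOnBase (coboundary n f) := by
  rw [coboundary_apply]
  refine VanishesOnBase.sub (vanishesOnBase_succ.2 fun a => ?_) hf.d
  rw [curry_mu]
  exact hf.lact _

theorem VanishesOnBase.row_eq_zero : ∀ {n : ℕ} (l : ℕ) {f : DualCochain k E n},
    O.VanishesOnBase f → O.row n l f = 0
  | 0, l, f, hf => by
    have : f = 0 := DualCochain.ext fun w c => by
      rw [Subsingleton.elim w (O.incl ∘ ![]), hf]
      rfl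
    rw [this, map_zero]
  | n + 1, l, f, hf => curry_ext fun b => by
    rw [vanishesOnBase_succ] at hf
    have : (fun m => O.row n m ∘ₗ curry f ∘ₗ O.incl.toLinearMap) = fun _ => 0 := by
      ext m a : 2
      exact (hf a).row_eq_zero m
    rw [curry_row, this, lift_zero]
    simp

theorem VanishesOnBase.extend_eq_zero {f : DualCochain k E n} (hf : O.VanishesOnBase f) :
    O.extend f = 0 := by
  refine curry.injective (O.hom_ext fun a m => ?_)
  rw [curry_extend, leftLinear_monomial, hf.row_eq_zero]
  simp

theorem VanishesOnBase.prism : ∀ {n : ℕ} {f : DualCochain k E (n + 1)},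
    O.VanishesOnBase f → O.VanishesOnBase (O.prism n 0 f)
  | 0, f, hf => by
    rw [prism_zero, pow_zero, ← map_one O.incl]
    exact vanishesOnBase_succ.1 hf 1
  | n + 1, f, hf => vanishesOnBase_succ.2 fun a => by
    rw [vanishesOnBase_succ] at hf
    rw [curry_prism, pow_zero, one_mul, lift_incl, ← map_one O.incl]
    exact (vanishesOnBase_succ.1 (hf 1) a).sub (hf a).prism

theorem prism_eq_of_curry_incl {f : DualCochain k E (n + 1)} (hf : ∀ a, curry f (O.incl a) = 0)
    (l : ℕ) : O.prism n l f = curry f (O.var ^ l) := by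
  cases n with
  | zero => simp
  | succ n =>
    refine curry_ext fun b => ?_
    have : (fun m => O.prism n m ∘ₗ curry f ∘ₗ O.incl.toLinearMap) = fun _ => 0 := by
      ext m a : 2
      simp [hf a]
    rw [curry_prism, this, lift_zero]
    simp

variable (O)

/-- The transgression of the restriction of a cochain to words in `A`, a cochain of `E` of one
degree more which vanishes when its first argument lies in `A`. -/
def transgress : DualCochain k E n →ₗ[k] DualCochain k E (n + 1) := O.contract ∘ₗ O.extend

theorem coboundary_transgress (f : DualCochain k E n) :
    coboundary (n + 1) (O.transgress f) = - O.transgress (coboundary n f) := by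
  have h : O.Balanced (curry (O.extend f)) := by
    rw [curry_extend]; exact O.leftLinear_balanced _
  rw [transgress, LinearMap.comp_apply, O.coboundary_contract h, d_extend]
  rfl

theorem curry_transgress_incl (f : DualCochain k E n) (a : A) :
    curry (O.transgress f) (O.incl a) = 0 := by
  simp [transgress]

variable {O}

theorem VanishesOnBase.transgress_eq_zero {f : DualCochain k E n} (hf : O.VanishesOnBase f) :
    O.transgress f = 0 := by
  rw [transgress, LinearMap.comp_apply, hf.extend_eq_zero, map_zero]

/-- Exactness, at the cohomology of `E`, of the long exact sequence that relates the Hochschild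
cohomology of `E` to that of `A`: a cocycle which vanishes on words in `A` is cohomologous to a
transgression, through a cochain which again vanishes on words in `A`. -/
theorem exists_eq_coboundary_add_transgress {f : DualCochain k E (n + 1)}
    (hf : coboundary (n + 1) f = 0) (hf' : O.VanishesOnBase f) :
    ∃ g h : DualCochain k E n, O.VanishesOnBase g ∧ f = coboundary n g + O.transgress h := by
  set Φ := O.homotopy f with hΦ
  have bΦ : O.Balanced (curry Φ) := by
    rw [hΦ, curry_homotopy]; exact O.leftLinear_balanced _
  have dΦ : d (n + 1) Φ = mu f := by
    have := O.homotopy_coboundary f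
    rwa [hf, homotopy_zero, zero_add, hf'.extend_eq_zero, sub_zero] at this
  -- `Φ` is left `A`-linear with `d Φ = mu f`; its commutator `F` with `x` is a cocycle, and the
  -- contraction of `F` differs from `f` by a coboundary.
  set F := O.commVar Φ with hF
  have bF : O.Balanced (curry F) := O.balanced_commVar bΦ
  have dF : d (n + 1) F = 0 := by rw [hF, d_commVar, dΦ, commVar_mu]
  set F1 := curry F 1
  have h1 : f = coboundary n (curry Φ 1) + O.contract F := by
    refine curry_ext fun b => ?_
    rw [map_add, LinearMap.add_apply, coboundary_curry_one, dΦ, O.curry_contract_commVar bΦ]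
    simp
  have h2 : ∀ b, curry (coboundary n F1) b = - (curry F b - lact b F1) := by
    intro b
    rw [coboundary_curry_one, dF]
    simp [F1]
  have h3 : O.homotopy (coboundary n F1) = mu F1 - F := by
    refine curry.injective (O.hom_ext fun a l => ?_)
    rw [curry_homotopy, leftLinear_monomial, prism_eq_of_curry_incl, h2]
    · simp [bF a, lact_mul]
    · intro a
      have := bF a 1
      rw [mul_one] at this
      rw [h2, this, sub_self, neg_zero]
  have hv : O.VanishesOnBase (curry Φ 1) := by
    rw [hΦ, curry_homotopy, leftLinear_one]
    exact hf'.prism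
  cases n with
  | zero =>
    have h4 := O.homotopy_coboundary_zero F1
    rw [h3] at h4
    refine ⟨_, F1, hv, ?_⟩
    rw [h1, sub_right_injective h4]
    rfl
  | succ n =>
    have h4 := O.homotopy_coboundary F1
    rw [h3] at h4
    have h5 : F = O.extend F1 + d (n + 1) (O.homotopy F1) :=
      sub_right_injective ((eq_sub_of_add_eq h4).trans (sub_sub _ _ _))
    have bH : O.Balanced (curry (O.homotopy F1)) := by
      rw [curry_homotopy]; exact O.leftLinear_balanced _
    refine ⟨curry Φ 1 - O.contract (O.homotopy F1), F1,
      hv.sub (vanishesOnBase_succ.2 fun a => ?_), ?_⟩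
    · rw [curry_contract, fox_incl]
      exact fun _ => rfl
    · have h6 := O.coboundary_contract bH
      rw [map_sub, h6]
      nth_rewrite 1 [h1]
      rw [h5, map_add, transgress, LinearMap.comp_apply]
      abel

end OreExtension

/-! ### The operator induced by Connes' operator on transgressions -/

namespace OreExtension

open DualCochain

variable {k A E : Type*} [Field k] [Ring A] [Algebra k A] {δ : A →ₗ[k] A} [Ring E] [Algebra k E]
  (O : OreExtension δ E) {n : ℕ}

/-- The transgression followed by insertion of `1` in the place of the values: this is Connes'
operator applied to a transgression, up to cochains which vanish on words in `A`. On words in `A` it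
is `m` times the shift from `x^{m-1}` to `xᵐ`, up to terms of lower degree in `x`. -/
def symbol : DualCochain k E n →ₗ[k] DualCochain k E n :=
  ofCyclic.toLinearMap ∘ₗ CyclicCochain.extraDegen n ∘ₗ ofCyclic.symm.toLinearMap ∘ₗ O.transgress

theorem symbol_apply (f : DualCochain k E n) (w : Fin n → E) (c : E) :
    O.symbol f w c = curry (O.transgress f) c w 1 := rfl

theorem sum_apply {ι : Type*} (s : Finset ι) (f : ι → DualCochain k E n) (w : Fin n → E) :
    (∑ i ∈ s, f i) w = ∑ i ∈ s, f i w := by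
  classical
  induction s using Finset.induction_on with
  | empty => rfl
  | insert i s hi ih => rw [Finset.sum_insert hi, Finset.sum_insert hi, DualCochain.add_apply, ih]

theorem symbol_monomial (f : DualCochain k E n) (w : Fin n → E) (a : A) (m : ℕ) :
    O.symbol f w (O.incl a * O.var ^ m) =
      ∑ l ∈ Finset.range m, O.row n l f w (O.incl a * O.var ^ (m - 1 - l)) := by
  rw [symbol_apply, transgress, LinearMap.comp_apply, curry_contract, fox_monomial, sum_apply,
    LinearMap.sum_apply]
  simp [lact_apply]

variable {O}

/-- The terms of `row l f` besides the leading one involve only values of `f` at monomials of degree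
less than `l + j`. -/
theorem row_apply_of_vanishes : ∀ {n : ℕ} {f : DualCochain k E n} {r : ℕ},
    (∀ (w : Fin n → A), ∀ j < r, ∀ a, f (O.incl ∘ w) (O.incl a * O.var ^ j) = 0) →
    ∀ {l j : ℕ}, l + j ≤ r → ∀ (w : Fin n → A) (a : A),
      O.row n l f (O.incl ∘ w) (O.incl a * O.var ^ j) =
        f (O.incl ∘ w) (O.incl a * O.var ^ (l + j))
  | 0, f, r, hf, l, j, hlj, w, a => by
    have h : ∀ e ∈ Submodule.span k {e | ∃ c : A, ∃ i < l, e = O.incl c * O.var ^ i},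
        f (O.incl ∘ w) (e * O.var ^ j) = 0 := by
      intro e he
      induction he using Submodule.span_induction with
      | mem e he =>
        obtain ⟨c, i, hi, rfl⟩ := he
        rw [mul_assoc, ← pow_add]
        exact hf w _ (by omega) c
      | zero => simp
      | add u v _ _ hu hv => rw [add_mul, map_add, hu, hv, add_zero]
      | smul c u _ hu => rw [smul_mul_assoc, map_smul, hu, smul_zero]
    have h' := h _ (O.pow_mul_monomial_mem l a)
    rw [sub_mul, map_sub, sub_eq_zero, mul_assoc, mul_assoc, ← pow_add] at h'
    rw [row_zero, ract_apply, h']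
  | n + 1, f, r, hf, l, j, hlj, w, a => by
    have hf' : ∀ b, ∀ (w : Fin n → A), ∀ j < r, ∀ a,
        curry f (O.incl b) (O.incl ∘ w) (O.incl a * O.var ^ j) = 0 := by
      intro b w j hj a
      rw [curry_apply, ← cons_comp]
      exact hf _ j hj a
    have h : ∀ e ∈ Submodule.span k {e | ∃ c : A, ∃ i < l, e = O.incl c * O.var ^ i},
        O.lift (fun m => O.row n m ∘ₗ curry f ∘ₗ O.incl.toLinearMap) e (O.incl ∘ Fin.tail w)
          (O.incl a * O.var ^ j) = 0 := by
      intro e he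
      induction he using Submodule.span_induction with
      | mem e he =>
        obtain ⟨c, i, hi, rfl⟩ := he
        rw [lift_monomial]
        exact (row_apply_of_vanishes (hf' c) (by omega) _ a).trans (hf' c _ _ (by omega) a)
      | zero => simp
      | add u v _ _ hu hv =>
        rw [map_add, DualCochain.add_apply, LinearMap.add_apply, hu, hv, add_zero]
      | smul c u _ hu =>
        rw [map_smul, DualCochain.smul_apply, LinearMap.smul_apply, hu, smul_zero]
    have h' := h _ (O.pow_mul_monomial_mem l (w 0))
    rw [map_sub, DualCochain.sub_apply, LinearMap.sub_apply, sub_eq_zero, lift_monomial] at h'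
    rw [apply_eq_curry, curry_row]
    refine h'.trans ((row_apply_of_vanishes (hf' (w 0)) hlj _ a).trans ?_)
    rw [apply_eq_curry f]
    rfl

/-- The leading term of `symbol`: each of the `m` summands contributes once. -/
theorem symbol_of_vanishes {f : DualCochain k E n} {r : ℕ}
    (hf : ∀ (w : Fin n → A), ∀ j < r, ∀ a, f (O.incl ∘ w) (O.incl a * O.var ^ j) = 0)
    {m : ℕ} (hm : m ≤ r + 1) (w : Fin n → A) (a : A) :
    O.symbol f (O.incl ∘ w) (O.incl a * O.var ^ m) =
      m * f (O.incl ∘ w) (O.incl a * O.var ^ (m - 1)) := by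
  rw [symbol_monomial]
  refine (Finset.sum_congr rfl fun l hl => ?_).trans (by
    rw [Finset.sum_const, Finset.card_range, nsmul_eq_mul])
  have := Finset.mem_range.1 hl
  rw [row_apply_of_vanishes hf (by omega)]
  congr 3
  omega

/-- Injectivity of `symbol`, by induction on the degree in `x`. -/
theorem vanishesOnBase_of_symbol [CharZero k] {f : DualCochain k E n}
    (hf : O.VanishesOnBase (O.symbol f)) :
    O.VanishesOnBase f := by
  have h : ∀ r, ∀ (w : Fin n → A), ∀ j < r, ∀ a, f (O.incl ∘ w) (O.incl a * O.var ^ j) = 0 := by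
    intro r
    induction r with
    | zero => intro w j hj; omega
    | succ r ih =>
      intro w j hj a
      have := symbol_of_vanishes ih (show j + 1 ≤ r + 1 by omega) w a
      rw [hf, Nat.add_sub_cancel, LinearMap.zero_apply, zero_eq_mul] at this
      exact this.resolve_left (by exact_mod_cast Nat.succ_ne_zero j)
  exact fun w => O.hom_ext fun a m => h (m + 1) w m (by omega) a

variable (O) in
/-- Successive approximations to a preimage of `f` under `symbol`: the step from `r` to `r + 1`
corrects the values at the monomials of degree `r`, so that `symbol` agrees with `f` on words in `A`
also at the monomials of degree `r + 1`. -/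
def approx (f : DualCochain k E n) : ℕ → DualCochain k E n
  | 0 => 0
  | r + 1 => approx f r + ((r + 1 : ℕ) : k)⁻¹ • compValues
      { toFun := fun L => O.lift fun m => if m = r then
          L ∘ₗ LinearMap.mulRight k (O.var ^ (m + 1)) ∘ₗ O.incl.toLinearMap else 0
        map_add' := fun L L' => O.hom_ext fun a m => by
          by_cases h : m = r <;> simp [h]
        map_smul' := fun c L => O.hom_ext fun a m => by
          by_cases h : m = r <;> simp [h] } (f - O.symbol (approx f r))

variable (O) in
theorem approx_succ_monomial (f : DualCochain k E n) (r : ℕ) (w : Fin n → E) (a : A) (m : ℕ) :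
    O.approx f (r + 1) w (O.incl a * O.var ^ m) = O.approx f r w (O.incl a * O.var ^ m) +
      if m = r then ((r + 1 : ℕ) : k)⁻¹ * (f w (O.incl a * O.var ^ (m + 1)) -
        O.symbol (O.approx f r) w (O.incl a * O.var ^ (m + 1))) else 0 := by
  rw [approx]
  by_cases h : m = r <;> simp [h]

theorem symbol_eq_of_eq {f g : DualCochain k E n} {r : ℕ}
    (hfg : ∀ (w : Fin n → A), ∀ j < r, ∀ a,
      f (O.incl ∘ w) (O.incl a * O.var ^ j) = g (O.incl ∘ w) (O.incl a * O.var ^ j))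
    {m : ℕ} (hm : m ≤ r) (w : Fin n → A) (a : A) :
    O.symbol f (O.incl ∘ w) (O.incl a * O.var ^ m) =
      O.symbol g (O.incl ∘ w) (O.incl a * O.var ^ m) := by
  have hv : ∀ (w : Fin n → A), ∀ j < r, ∀ a, (f - g) (O.incl ∘ w) (O.incl a * O.var ^ j) = 0 := by
    intro w j hj a
    rw [DualCochain.sub_apply, LinearMap.sub_apply, hfg w j hj a, sub_self]
  have h := symbol_of_vanishes hv (show m ≤ r + 1 by omega) w a
  rw [map_sub, DualCochain.sub_apply, LinearMap.sub_apply] at h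
  rw [← sub_eq_zero, h]
  cases m with
  | zero => simp
  | succ m => rw [Nat.add_sub_cancel, hv w m (by omega), mul_zero]

theorem symbol_approx [CharZero k] {f : DualCochain k E n}
    (hf : ∀ (w : Fin n → A) a, f (O.incl ∘ w) (O.incl a) = 0) (r : ℕ) :
    ∀ m ≤ r, ∀ (w : Fin n → A) (a : A),
      O.symbol (O.approx f r) (O.incl ∘ w) (O.incl a * O.var ^ m) =
        f (O.incl ∘ w) (O.incl a * O.var ^ m) := by
  induction r with
  | zero =>
    intro m hm w a
    obtain rfl : m = 0 := by omega
    rw [symbol_monomial]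
    simp [hf]
  | succ r ih =>
    intro m hm w a
    have hd : ∀ (w : Fin n → A), ∀ j < r, ∀ a, (O.approx f (r + 1) - O.approx f r) (O.incl ∘ w)
        (O.incl a * O.var ^ j) = 0 := by
      intro w j hj a
      rw [DualCochain.sub_apply, LinearMap.sub_apply, approx_succ_monomial, if_neg (by omega)]
      simp
    have h := symbol_of_vanishes hd hm w a
    rw [map_sub, DualCochain.sub_apply, LinearMap.sub_apply, sub_eq_iff_eq_add] at h
    rw [h, DualCochain.sub_apply, LinearMap.sub_apply, approx_succ_monomial]
    by_cases hmr : m = r + 1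
    · subst hmr
      have : ((r + 1 : ℕ) : k) ≠ 0 := Nat.cast_ne_zero.2 (by omega)
      rw [Nat.add_sub_cancel, if_pos rfl, add_sub_cancel_left, ← mul_assoc, mul_inv_cancel₀ this]
      ring
    · rw [ih m (by omega)]
      by_cases hm0 : m = 0
      · subst hm0; simp
      · rw [if_neg (by omega)]; simp

/-- Surjectivity of `symbol` onto the cochains that vanish on `A`. The approximations become
stationary at each monomial, so their limit exists. -/
theorem exists_symbol_eq [CharZero k] {f : DualCochain k E n}
    (hf : ∀ (w : Fin n → A) a, f (O.incl ∘ w) (O.incl a) = 0) :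
    ∃ g : DualCochain k E n, O.VanishesOnBase (O.symbol g - f) := by
  let L : (ℕ → E →ₗ[k] k) →ₗ[k] (E →ₗ[k] k) :=
    { toFun := fun s => O.lift fun m =>
        s m ∘ₗ LinearMap.mulRight k (O.var ^ m) ∘ₗ O.incl.toLinearMap
      map_add' := fun s t => O.hom_ext fun a m => by simp
      map_smul' := fun c s => O.hom_ext fun a m => by simp }
  let g : DualCochain k E n := L.compMultilinearMap
    (MultilinearMap.pi fun m => (O.approx f (m + 1) : MultilinearMap k (fun _ : Fin n => E) _))
  have hg : ∀ w a m, g w (O.incl a * O.var ^ m) = O.approx f (m + 1) w (O.incl a * O.var ^ m) := by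
    intro w a m
    exact O.lift_monomial _ a m
  have hr : ∀ r, ∀ m < r, ∀ w a, g w (O.incl a * O.var ^ m) =
      O.approx f r w (O.incl a * O.var ^ m) := by
    intro r m hm w a
    rw [hg]
    obtain ⟨s, rfl⟩ : ∃ s, r = m + 1 + s := ⟨r - (m + 1), by omega⟩
    induction s with
    | zero => rfl
    | succ s ih =>
      rw [← add_assoc]
      refine (ih (by omega)).trans ?_
      rw [O.approx_succ_monomial f (m + 1 + s), if_neg (by omega), add_zero]
  refine ⟨g, fun w => O.hom_ext fun a m => ?_⟩
  rw [DualCochain.sub_apply, LinearMap.sub_apply,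
    symbol_eq_of_eq (fun w j hj a => hr m j hj _ a) le_rfl, symbol_approx hf m m le_rfl, sub_self]
  rfl

end OreExtension

/-! ### The mixed complex of cyclic cochains -/

namespace CyclicCochain

variable {k E : Type*} [Field k] [Ring E] [Algebra k E]

open DualCochain

theorem b_b (n : ℕ) (φ : CyclicCochain k E n) : b (n + 1) (b n φ) = 0 :=
  ofCyclic.injective (by rw [ofCyclic_b, ofCyclic_b, coboundary_coboundary, map_zero])

/-- The signed cyclic operator `t = (-1)ⁿ τ`. -/
def scyc (n : ℕ) : Module.End k (CyclicCochain k E n) := (-1 : k) ^ n • cyc n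

theorem scyc_apply (n : ℕ) (φ : CyclicCochain k E n) : scyc n φ = (-1 : k) ^ n • cyc n φ := rfl

theorem cyc_pow_apply (n : ℕ) : ∀ (i : ℕ) (φ : CyclicCochain k E n) (v : Fin (n + 1) → E),
    (cyc n ^ i) φ v = φ fun j => v (j - i • 1)
  | 0, φ, v => by simp
  | i + 1, φ, v => by
    rw [pow_succ', Module.End.mul_apply, cyc_apply, cyc_pow_apply n i]
    congr 2
    funext j
    rw [succ_nsmul, sub_sub]

theorem scyc_pow (n : ℕ) : (scyc n : Module.End k (CyclicCochain k E n)) ^ (n + 1) = 1 := by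
  rw [scyc, smul_pow, ← pow_mul, (Nat.even_mul_succ_self n).neg_one_pow, one_smul]
  refine LinearMap.ext fun φ => MultilinearMap.ext fun v => ?_
  have : (n + 1) • (1 : Fin (n + 1)) = 0 := by
    simpa using card_nsmul_eq_zero' (x := (1 : Fin (n + 1)))
  rw [cyc_pow_apply]
  simp only [this, sub_zero]
  rfl

theorem norm_eq (n : ℕ) : (norm n : Module.End k (CyclicCochain k E n)) =
    ∑ i ∈ Finset.range (n + 1), scyc n ^ i := by
  refine Finset.sum_congr rfl fun i _ => ?_
  rw [scyc, smul_pow, ← pow_mul, mul_comm n]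

theorem scyc_mul_norm (n : ℕ) :
    (scyc n : Module.End k (CyclicCochain k E n)) * norm n = norm n := by
  rw [norm_eq, Finset.mul_sum, Finset.sum_range_succ, Finset.sum_range_succ', ← pow_succ',
    scyc_pow, pow_zero]
  simp only [pow_succ']

theorem norm_mul_scyc (n : ℕ) :
    (norm n : Module.End k (CyclicCochain k E n)) * scyc n = norm n := by
  rw [norm_eq, Finset.sum_mul, Finset.sum_range_succ, Finset.sum_range_succ', ← pow_succ,
    scyc_pow, pow_zero]
  simp only [pow_succ]

theorem norm_mul_scyc_pow (n i : ℕ) :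
    (norm n : Module.End k (CyclicCochain k E n)) * scyc n ^ i = norm n := by
  induction i with
  | zero => simp
  | succ i ih => rw [pow_succ, ← mul_assoc, ih, norm_mul_scyc]

theorem B_apply (n : ℕ) (φ : CyclicCochain k E (n + 1)) :
    B n φ = norm n (extraDegen n (φ - scyc (n + 1) φ)) := rfl

/-- The signed coface maps, the last one being the cyclic image of the zeroth. -/
def sface {n : ℕ} : Fin (n + 2) → CyclicCochain k E n →ₗ[k] CyclicCochain k E (n + 1) :=
  Fin.snoc (α := fun _ => CyclicCochain k E n →ₗ[k] CyclicCochain k E (n + 1))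
    (fun i => (-1 : k) ^ (i : ℕ) • face i) (scyc (n + 1) ∘ₗ face 0)

theorem sface_castSucc {n : ℕ} (i : Fin (n + 1)) :
    (sface i.castSucc : CyclicCochain k E n →ₗ[k] _) = (-1 : k) ^ (i : ℕ) • face i := by
  simp [sface]

theorem sface_last {n : ℕ} :
    (sface (Fin.last (n + 1)) : CyclicCochain k E n →ₗ[k] _) = scyc (n + 1) ∘ₗ face 0 := by
  simp [sface]

theorem b_eq (n : ℕ) : (b n : CyclicCochain k E n →ₗ[k] _) = ∑ i, sface i := by
  simp only [Fin.sum_univ_castSucc (n := n + 1), sface_castSucc, sface_last]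
  rfl

/-- The Hochschild coboundary without its last term. It is contractible, by `extraDegen`. -/
def b' (n : ℕ) : CyclicCochain k E n →ₗ[k] CyclicCochain k E (n + 1) :=
  ∑ i : Fin (n + 1), sface i.castSucc

theorem cyc_face_succ {n : ℕ} (i : Fin (n + 1)) (φ : CyclicCochain k E (n + 1)) :
    cyc (n + 2) (face i.succ φ) = face i.castSucc (cyc (n + 1) φ) := by
  ext v
  rw [cyc_apply, face_apply, face_apply, cyc_apply, ← Fin.succ_castSucc, contractNth_succ]
  congr 1
  funext j
  cases j using Fin.cases with
  | zero =>
    rw [Fin.cons_zero, zero_sub_one, zero_sub_one, Fin.contractNth_apply_of_gt]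
    · rfl
    · simpa using i.is_le
  | succ j =>
    rw [Fin.cons_succ, succ_sub_one]
    have h : (Fin.tail fun j : Fin (n + 3) => v (j - 1)) = Fin.init v := by
      funext l
      rw [Fin.tail, succ_sub_one]
      rfl
    rw [h]
    have e : ∀ l : Fin (n + 1), (⟨l, by omega⟩ : Fin (n + 3)) = l.castSucc.castSucc := fun _ => rfl
    simp [Fin.contractNth, Fin.init]

theorem cyc_cyc_face_zero {n : ℕ} (φ : CyclicCochain k E n) :
    cyc (n + 1) (cyc (n + 1) (face 0 φ)) = face (Fin.last n) (cyc n φ) := by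
  ext v
  rw [cyc_apply, cyc_apply, face_apply, face_apply, cyc_apply, Fin.castSucc_zero, contractNth_zero]
  congr 1
  have h0 : (0 - 1 - 1 : Fin (n + 2)) = (Fin.last n).castSucc := by
    rw [zero_sub_one, ← Fin.succ_last, succ_sub_one]
  funext j
  cases j using Fin.cases with
  | zero =>
    have h1 : (0 - 1 : Fin (n + 1)) = Fin.last n := sub_eq_iff_eq_add.2 (Fin.last_add_one _).symm
    rw [Fin.cons_zero, h0, sub_self, zero_sub_one, h1, Fin.contractNth_apply_of_eq _ _ _ _ rfl]
    rfl
  | succ j =>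
    cases n with
    | zero => exact j.elim0
    | succ n =>
    rw [Fin.cons_succ, Fin.tail, Fin.tail, succ_sub_one, ← Fin.succ_castSucc, succ_sub_one,
      succ_sub_one, Fin.contractNth_apply_of_lt]
    simpa using j.is_le

theorem scyc_sface_succ {n : ℕ} (i : Fin (n + 1)) (φ : CyclicCochain k E n) :
    scyc (n + 1) (sface i.succ φ) = sface i.castSucc (scyc n φ) := by
  cases i using Fin.lastCases with
  | last =>
    rw [Fin.succ_last, sface_last, sface_castSucc]
    simp only [LinearMap.comp_apply, scyc_apply, LinearMap.smul_apply, map_smul, cyc_cyc_face_zero,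
      smul_smul, Fin.val_last, ← pow_add]
    rw [Even.neg_one_pow ⟨_, rfl⟩, Even.neg_one_pow ⟨_, rfl⟩]
  | cast i =>
    cases n with
    | zero => exact i.elim0
    | succ n =>
    rw [Fin.succ_castSucc, sface_castSucc, sface_castSucc]
    simp only [scyc_apply, LinearMap.smul_apply, map_smul, cyc_face_succ, smul_smul, ← pow_add,
      Fin.val_succ, Fin.val_castSucc]
    congr 1
    rw [show (i : ℕ) + 1 + (n + 1 + 1) = 2 + (n + 1 + i) by ring, pow_add]
    simp

theorem sub_scyc_b (n : ℕ) (φ : CyclicCochain k E n) :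
    b n φ - scyc (n + 1) (b n φ) = b' n (φ - scyc n φ) := by
  have h1 : b n φ = b' n φ + scyc (n + 1) (face 0 φ) := by
    rw [b_eq, b', LinearMap.sum_apply, Fin.sum_univ_castSucc, sface_last, LinearMap.sum_apply]
    rfl
  have h2 : scyc (n + 1) (b n φ) = scyc (n + 1) (face 0 φ) + b' n (scyc n φ) := by
    rw [b_eq, b', LinearMap.sum_apply, map_sum, Fin.sum_univ_succ, ← Fin.castSucc_zero,
      sface_castSucc, Fin.val_zero, pow_zero, one_smul, LinearMap.sum_apply]
    simp only [scyc_sface_succ]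
  rw [h2, h1, map_sub]
  abel

theorem scyc_pow_sface {n : ℕ} (i : Fin (n + 2)) (φ : CyclicCochain k E n) :
    (scyc (n + 1) ^ (i : ℕ)) (sface i φ) = sface 0 ((scyc n ^ (i : ℕ)) φ) := by
  induction i using Fin.induction generalizing φ with
  | zero => rfl
  | succ i ih =>
    rw [Fin.val_succ, pow_succ, Module.End.mul_apply, scyc_sface_succ]
    exact ih _

/-- Both sides are `N ∂₀ N`. -/
theorem norm_b' (n : ℕ) (φ : CyclicCochain k E n) : norm (n + 1) (b' n φ) = b n (norm n φ) := by
  have h1 : norm (n + 1) (b' n φ) = norm (n + 1) (sface 0 (norm n φ)) := by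
    rw [norm_eq n, b', LinearMap.sum_apply, LinearMap.sum_apply, map_sum, map_sum, map_sum,
      Finset.sum_range]
    refine Finset.sum_congr rfl fun i _ => ?_
    have := scyc_pow_sface i.castSucc φ
    rw [Fin.val_castSucc] at this
    rw [← this, ← Module.End.mul_apply (norm _), norm_mul_scyc_pow]
  have hN : ∀ i : ℕ, (scyc n ^ i) (norm n φ) = norm n φ := by
    intro i
    induction i with
    | zero => rfl
    | succ i ih => rw [pow_succ', Module.End.mul_apply, ih, ← Module.End.mul_apply, scyc_mul_norm]
  have h2 : ∀ i : Fin (n + 2),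
      sface i (norm n φ) = (scyc (n + 1) ^ (n + 2 - i : ℕ)) (sface 0 (norm n φ)) := by
    intro i
    have := scyc_pow_sface i (norm n φ)
    rw [hN] at this
    rw [← this, ← Module.End.mul_apply, ← pow_add, Nat.sub_add_cancel (by omega), scyc_pow]
    rfl
  rw [h1, b_eq, LinearMap.sum_apply, ← scyc_mul_norm, norm_eq (n + 1), Finset.mul_sum,
    LinearMap.sum_apply, ← Finset.sum_range_reflect, Finset.sum_range]
  refine Finset.sum_congr rfl fun i _ => ?_
  have : n + 1 + 1 - 1 - (i : ℕ) + 1 = n + 2 - i := by omega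
  rw [← pow_succ', this]
  exact (h2 i).symm

theorem extraDegen_sface_zero (n : ℕ) (φ : CyclicCochain k E n) :
    extraDegen n (face 0 φ) = φ := by
  ext v
  rw [extraDegen_apply, face_apply, Fin.castSucc_zero, contractNth_zero]
  simp

theorem extraDegen_face_succ {n : ℕ} (i : Fin (n + 1)) (φ : CyclicCochain k E (n + 1)) :
    extraDegen (n + 1) (face i.succ φ) = face i (extraDegen n φ) := by
  ext v
  rw [extraDegen_apply, face_apply, face_apply, extraDegen_apply, ← Fin.succ_castSucc,
    contractNth_succ]
  simp

theorem extraDegen_b'_zero (φ : CyclicCochain k E 0) : extraDegen 0 (b' 0 φ) = φ := by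
  simp [b', sface_castSucc, extraDegen_sface_zero, -Fin.castSucc_zero]

theorem extraDegen_b' (n : ℕ) (φ : CyclicCochain k E (n + 1)) :
    extraDegen (n + 1) (b' (n + 1) φ) = φ - b' n (extraDegen n φ) := by
  simp only [b', sface_castSucc, LinearMap.sum_apply, map_sum, LinearMap.smul_apply, map_smul]
  rw [Fin.sum_univ_succ]
  have h : ∀ i : Fin (n + 1), (-1 : k) ^ (i.succ : ℕ) • extraDegen (n + 1) (face i.succ φ) =
      -((-1 : k) ^ (i : ℕ) • face i (extraDegen n φ)) := fun i => by
    rw [extraDegen_face_succ, Fin.val_succ, pow_succ, mul_neg_one]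
    exact neg_smul (M := CyclicCochain k E (n + 1)) _ _
  simp only [h, extraDegen_sface_zero, Fin.val_zero, Finset.sum_neg_distrib, pow_zero, one_smul]
  abel

theorem norm_sub_scyc (n : ℕ) (φ : CyclicCochain k E n) : norm n (φ - scyc n φ) = 0 := by
  rw [map_sub, ← Module.End.mul_apply, norm_mul_scyc, sub_self]

theorem B_b_zero (φ : CyclicCochain k E 0) : B 0 (b 0 φ) = 0 := by
  rw [B_apply, sub_scyc_b, extraDegen_b'_zero, norm_sub_scyc]

theorem B_b (n : ℕ) (φ : CyclicCochain k E (n + 1)) : B (n + 1) (b (n + 1) φ) = -b n (B n φ) := by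
  rw [B_apply, sub_scyc_b, extraDegen_b', map_sub, norm_sub_scyc, zero_sub, norm_b', B_apply]

theorem B_B (n : ℕ) (φ : CyclicCochain k E (n + 2)) : B n (B (n + 1) φ) = 0 := by
  rw [B_apply, B_apply, ← Module.End.mul_apply, scyc_mul_norm, sub_self, map_zero, map_zero]

end CyclicCochain

namespace PeriodicCochain

variable {k E : Type*} [Field k] [Ring E] [Algebra k E]

open CyclicCochain

theorem d_lof_zero (φ : CyclicCochain k E 0) :
    d k E (DirectSum.lof k ℕ (CyclicCochain k E) 0 φ) =
      DirectSum.lof k ℕ (CyclicCochain k E) 1 (b 0 φ) := by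
  rw [d, DirectSum.toModule_lof]
  simp [BComponent]

theorem d_lof_succ {n : ℕ} (φ : CyclicCochain k E (n + 1)) :
    d k E (DirectSum.lof k ℕ (CyclicCochain k E) (n + 1) φ) =
      DirectSum.lof k ℕ (CyclicCochain k E) (n + 2) (b (n + 1) φ) +
      DirectSum.lof k ℕ (CyclicCochain k E) n (B n φ) := by
  rw [d, DirectSum.toModule_lof]
  rfl

theorem d_d (x : PeriodicCochain k E) : d k E (d k E x) = 0 := by
  suffices h : d k E ∘ₗ d k E = 0 from LinearMap.congr_fun h x
  refine DirectSum.linearMap_ext k fun n => LinearMap.ext fun φ => ?_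
  simp only [LinearMap.comp_apply, LinearMap.zero_apply]
  match n, φ with
  | 0, φ => rw [d_lof_zero, d_lof_succ, b_b, B_b_zero, map_zero, map_zero, add_zero]
  | 1, φ =>
    rw [d_lof_succ, map_add, d_lof_succ, d_lof_zero, b_b, B_b, map_zero, map_neg, zero_add]
    exact neg_add_cancel _
  | n + 2, φ =>
    rw [d_lof_succ, map_add, d_lof_succ, d_lof_succ, b_b, B_b, B_B, map_zero, map_zero, map_neg,
      zero_add, add_zero]
    exact neg_add_cancel _

end PeriodicCochain

/-! ### Exactness of Connes' operator on relative Hochschild cohomology -/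

namespace DualCochain

variable {k E : Type*} [Field k] [Ring E] [Algebra k E]

/-- Connes' operator, transported along `ofCyclic`. -/
def connes (n : ℕ) : DualCochain k E (n + 1) →ₗ[k] DualCochain k E n :=
  ofCyclic.toLinearMap ∘ₗ CyclicCochain.B n ∘ₗ ofCyclic.symm.toLinearMap

theorem connes_ofCyclic {n : ℕ} (φ : CyclicCochain k E (n + 1)) :
    connes n (ofCyclic φ) = ofCyclic (CyclicCochain.B n φ) := by
  simp [connes]

theorem connes_coboundary_zero (f : DualCochain k E 0) : connes 0 (coboundary 0 f) = 0 := by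
  obtain ⟨φ, rfl⟩ := ofCyclic.surjective f
  rw [← ofCyclic_b, connes_ofCyclic, CyclicCochain.B_b_zero, map_zero]

theorem connes_coboundary {n : ℕ} (f : DualCochain k E (n + 1)) :
    connes (n + 1) (coboundary (n + 1) f) = -coboundary n (connes n f) := by
  obtain ⟨φ, rfl⟩ := ofCyclic.surjective f
  rw [← ofCyclic_b, connes_ofCyclic, connes_ofCyclic, CyclicCochain.B_b, ← ofCyclic_b]
  exact map_neg ofCyclic _

theorem connes_connes {n : ℕ} (f : DualCochain k E (n + 2)) :
    connes n (connes (n + 1) f) = 0 := by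
  obtain ⟨φ, rfl⟩ := ofCyclic.surjective f
  rw [connes_ofCyclic, connes_ofCyclic, CyclicCochain.B_B, map_zero]

end DualCochain

theorem Fin.nsmul_one_eq {n : ℕ} : ∀ {i : ℕ} (hi : i < n + 1), i • (1 : Fin (n + 1)) = ⟨i, hi⟩
  | 0, _ => by simp
  | i + 1, hi => by
    rw [succ_nsmul, Fin.nsmul_one_eq (by omega : i < n + 1)]
    refine Fin.ext ?_
    rw [Fin.val_add, Fin.val_one', Nat.mod_eq_of_lt (by omega : 1 < n + 1)]
    exact Nat.mod_eq_of_lt hi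

namespace OreExtension

open DualCochain

variable {k A E : Type*} [Field k] [Ring A] [Algebra k A] {δ : A →ₗ[k] A} [Ring E] [Algebra k E]
  (O : OreExtension δ E) {n : ℕ}

/-- If a cochain vanishes when its second letter lies in `A`, then only one of the terms of Connes'
operator survives on a word `(c, a₁, …, aₙ)`: in all others `1` or some `aᵢ` is in that place. -/
theorem connes_apply_of_curry_incl {f : DualCochain k E (n + 1)}
    (hf : ∀ a, curry f (O.incl a) = 0) (w : Fin n → A) (c : E) :
    connes n f (O.incl ∘ w) c = curry f c (O.incl ∘ w) 1 := by
  obtain ⟨φ, rfl⟩ := ofCyclic.surjective f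
  have h : ∀ (a : A) (u : Fin (n + 2) → E), u 1 = O.incl a → φ u = 0 := by
    intro a u hu
    rw [← Fin.cons_self_tail u, ← ofCyclic_apply, apply_eq_curry]
    change curry _ (u 1) _ _ = 0
    rw [hu, hf]
    rfl
  rw [connes_ofCyclic, ofCyclic_apply, CyclicCochain.B_apply, CyclicCochain.norm]
  set χ := CyclicCochain.extraDegen n (φ - CyclicCochain.scyc (n + 1) φ) with hχ
  have hχ' : ∀ u : Fin (n + 1) → E, χ u = φ (Fin.cons 1 u : Fin (n + 2) → E) := by
    intro u
    have : CyclicCochain.cyc (n + 1) φ (Fin.cons 1 u : Fin (n + 2) → E) = 0 := by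
      rw [CyclicCochain.cyc_apply]
      refine h 1 _ ?_
      rw [sub_self, Fin.cons_zero, map_one]
    rw [hχ, CyclicCochain.extraDegen_apply]
    change φ _ - (-1 : k) ^ (n + 1) * CyclicCochain.cyc (n + 1) φ _ = _
    rw [this, mul_zero, sub_zero]
  rw [LinearMap.sum_apply, _root_.sum_apply, Finset.sum_eq_single_of_mem 0 (by simp)]
  · rw [zero_mul, pow_zero, one_smul, pow_zero, Module.End.one_apply, hχ', curry_apply,
      ofCyclic_apply]
  · intro i hi hi0
    change (-1 : k) ^ (i * n) * (CyclicCochain.cyc n ^ i) χ _ = 0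
    rw [CyclicCochain.cyc_pow_apply, hχ']
    have hi' : (0 - i • 1 : Fin (n + 1)) ≠ 0 := by
      rw [Fin.nsmul_one_eq (Finset.mem_range.1 hi), zero_sub, neg_ne_zero]
      exact fun h => hi0 (congrArg Fin.val h)
    obtain ⟨j, hj⟩ := Fin.exists_succ_eq.2 hi'
    rw [h (w j), mul_zero]
    rw [Fin.cons_one]
    rw [← hj, Fin.cons_succ]
    rfl

theorem vanishesOnBase_connes_transgress_sub_symbol (f : DualCochain k E n) :
    O.VanishesOnBase (connes n (O.transgress f) - O.symbol f) := fun w => by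
  refine LinearMap.ext fun c => ?_
  rw [DualCochain.sub_apply, LinearMap.sub_apply, symbol_apply,
    O.connes_apply_of_curry_incl (O.curry_transgress_incl f), sub_self]
  rfl

/-- The cochain vanishes when all its arguments, including that of the values, lie in `A`. -/
def IsRelative (f : DualCochain k E n) : Prop :=
  ∀ (w : Fin n → A) (a : A), f (O.incl ∘ w) (O.incl a) = 0

variable {O}

theorem isRelative_ofCyclic {φ : CyclicCochain k E n} :
    O.IsRelative (ofCyclic φ) ↔ CyclicCochain.pullback O.incl n φ = 0 := by
  have h : ∀ (w : Fin n → A) (a : A), ofCyclic φ (O.incl ∘ w) (O.incl a) =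
      CyclicCochain.pullback O.incl n φ (Fin.cons a w : Fin (n + 1) → A) := fun w a => by
    rw [ofCyclic_apply, ← cons_comp]
    rfl
  refine ⟨fun hφ => MultilinearMap.ext fun v => ?_, fun hφ w a => ?_⟩
  · rw [← Fin.cons_self_tail v, ← h, hφ]
    rfl
  · rw [h, hφ]
    rfl

theorem VanishesOnBase.isRelative {f : DualCochain k E n} (hf : O.VanishesOnBase f) :
    O.IsRelative f := fun w a => by
  rw [hf]
  rfl

theorem IsRelative.add {f g : DualCochain k E n} (hf : O.IsRelative f) (hg : O.IsRelative g) :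
    O.IsRelative (f + g) := fun w a => by
  rw [DualCochain.add_apply, LinearMap.add_apply, hf, hg, add_zero]

theorem IsRelative.sub {f g : DualCochain k E n} (hf : O.IsRelative f) (hg : O.IsRelative g) :
    O.IsRelative (f - g) := fun w a => by
  rw [DualCochain.sub_apply, LinearMap.sub_apply, hf, hg, sub_zero]

theorem IsRelative.connes {f : DualCochain k E (n + 1)} (hf : O.IsRelative f) :
    O.IsRelative (connes n f) := by
  obtain ⟨φ, rfl⟩ := ofCyclic.surjective f
  rw [connes_ofCyclic, isRelative_ofCyclic, CyclicCochain.pullback_B, isRelative_ofCyclic.1 hf,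
    map_zero]

variable (O) in
theorem isRelative_transgress (f : DualCochain k E n) : O.IsRelative (O.transgress f) := by
  intro w a
  rw [apply_eq_curry]
  change curry _ (O.incl (w 0)) _ _ = 0
  rw [curry_transgress_incl]
  rfl

theorem vanishesOnBase_symbol_coboundary_sub (f : DualCochain k E n) :
    O.VanishesOnBase (O.symbol (coboundary n f) - coboundary n (O.symbol f)) := by
  have h1 := O.vanishesOnBase_connes_transgress_sub_symbol (coboundary n f)
  have h2 := (O.vanishesOnBase_connes_transgress_sub_symbol f).coboundary
  rw [← neg_eq_iff_eq_neg.2 (O.coboundary_transgress f), map_neg, connes_coboundary, neg_neg] at h1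
  rw [map_sub] at h2
  have := h2.sub h1
  rwa [sub_sub_sub_cancel_left] at this

theorem transgress_congr [CharZero k] {f g : DualCochain k E n}
    (h : O.VanishesOnBase (O.symbol f - O.symbol g)) : O.transgress f = O.transgress g := by
  rw [← map_sub] at h
  rw [← sub_eq_zero, ← map_sub]
  exact (vanishesOnBase_of_symbol h).transgress_eq_zero

/-- A relative cocycle agrees on words in `A` with Connes' operator of a transgression, because
`symbol` is invertible. -/
theorem exists_vanishesOnBase_sub_connes [CharZero k] {f : DualCochain k E n}
    (hf : O.IsRelative f) (hf' : coboundary n f = 0) :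
    ∃ g : DualCochain k E (n + 1), O.IsRelative g ∧ coboundary (n + 1) g = 0 ∧
      O.VanishesOnBase (connes n g - f) := by
  obtain ⟨g, hg⟩ := exists_symbol_eq hf
  refine ⟨O.transgress g, O.isRelative_transgress g, ?_, ?_⟩
  · have h1 := hg.coboundary
    rw [map_sub, hf', sub_zero] at h1
    have h2 : O.VanishesOnBase (O.symbol (coboundary n g)) := by
      have := (vanishesOnBase_symbol_coboundary_sub (O := O) g).add h1
      rwa [sub_add_cancel] at this
    rw [coboundary_transgress, (vanishesOnBase_of_symbol h2).transgress_eq_zero, neg_zero]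
  · have := (O.vanishesOnBase_connes_transgress_sub_symbol g).add hg
    rwa [sub_add_sub_cancel] at this

theorem exists_eq_connes [CharZero k] {f : DualCochain k E 0} (hf : O.IsRelative f)
    (hf' : coboundary 0 f = 0) :
    ∃ g : DualCochain k E 1, O.IsRelative g ∧ coboundary 1 g = 0 ∧ f = connes 0 g := by
  obtain ⟨g, hg, hg', h⟩ := exists_vanishesOnBase_sub_connes hf hf'
  refine ⟨g, hg, hg', (sub_eq_zero.1 (DualCochain.ext fun w c => ?_)).symm⟩
  rw [Subsingleton.elim w (O.incl ∘ ![]), h]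
  rfl

theorem exists_eq_connes_add_coboundary_transgress [CharZero k] {f : DualCochain k E (n + 1)}
    (hf : O.IsRelative f) (hf' : coboundary (n + 1) f = 0) :
    ∃ (g : DualCochain k E (n + 2)) (h h' : DualCochain k E n), O.IsRelative g ∧
      coboundary (n + 2) g = 0 ∧ O.VanishesOnBase h ∧
      f = connes (n + 1) g + coboundary n h + O.transgress h' := by
  obtain ⟨g, hg, hg', h⟩ := exists_vanishesOnBase_sub_connes hf hf'
  obtain ⟨u, u', hu, hu'⟩ := exists_eq_coboundary_add_transgress (O := O)
    (f := f - connes (n + 1) g) (by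
      rw [map_sub, hf', ← neg_eq_iff_eq_neg.2 (connes_coboundary g), hg']; simp)
    (by
      have h0 : O.VanishesOnBase (0 : DualCochain k E (n + 1)) := fun _ => rfl
      have := h0.sub h
      rwa [zero_sub, neg_sub] at this)
  exact ⟨g, u, u', hg, hg', hu, by rw [add_assoc, ← hu', add_sub_cancel]⟩

/-- The case of degree one of `exists_eq_connes_add_coboundary`, where there is no cochain `e` in
degree `-1`. -/
theorem exists_eq_connes_add_coboundary_one [CharZero k] {f : DualCochain k E 1}
    (hf : O.IsRelative f) (hf' : coboundary 1 f = 0) (hf'' : connes 0 f = 0) :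
    ∃ (g : DualCochain k E 2) (h : DualCochain k E 0), O.IsRelative g ∧ coboundary 2 g = 0 ∧
      O.IsRelative h ∧ f = connes 1 g + coboundary 0 h := by
  obtain ⟨g, h, h', hg, hg', hh, rfl⟩ := exists_eq_connes_add_coboundary_transgress hf hf'
  refine ⟨g, h, hg, hg', hh.isRelative, ?_⟩
  rw [map_add, map_add, connes_connes, connes_coboundary_zero, zero_add, zero_add] at hf''
  have h1 := O.vanishesOnBase_connes_transgress_sub_symbol h'
  have h3 : O.transgress h' = O.transgress 0 := transgress_congr (by
    have h0 : O.VanishesOnBase (0 : DualCochain k E 0) := fun _ => rfl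
    have := h0.sub h1
    rwa [hf'', zero_sub, zero_sub, neg_neg, ← sub_zero (O.symbol h'), ← map_zero O.symbol] at this)
  rw [h3, map_zero, add_zero]

/-- A relative cocycle whose image under Connes' operator is a relative coboundary is itself in the
image of Connes' operator, modulo relative coboundaries. -/
theorem exists_eq_connes_add_coboundary [CharZero k] {f : DualCochain k E (n + 2)}
    (hf : O.IsRelative f) (hf' : coboundary (n + 2) f = 0) {e : DualCochain k E n}
    (he : O.IsRelative e) (hf'' : connes (n + 1) f = coboundary n e) :
    ∃ (g : DualCochain k E (n + 3)) (h : DualCochain k E (n + 1)), O.IsRelative g ∧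
      coboundary (n + 3) g = 0 ∧ O.IsRelative h ∧
      f = connes (n + 2) g + coboundary (n + 1) h := by
  obtain ⟨g, h, h', hg, hg', hh, rfl⟩ := exists_eq_connes_add_coboundary_transgress hf hf'
  obtain ⟨v, hv⟩ := exists_symbol_eq (he.add hh.isRelative.connes)
  refine ⟨g, h - O.transgress v, hg, hg', hh.isRelative.sub (O.isRelative_transgress v), ?_⟩
  rw [map_add, map_add, connes_connes, connes_coboundary, zero_add, neg_add_eq_iff_eq_add] at hf''
  have h1 := O.vanishesOnBase_connes_transgress_sub_symbol h'
  have h2 := vanishesOnBase_symbol_coboundary_sub (O := O) v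
  have h3 := hv.coboundary
  rw [map_sub, map_add] at h3
  have h4 : O.transgress h' = O.transgress (coboundary n v) := transgress_congr (by
    have h0 : O.VanishesOnBase (0 : DualCochain k E (n + 1)) := fun _ => rfl
    have := h0.sub ((h1.add h2).add h3)
    convert this using 1
    rw [hf'']
    abel)
  rw [h4, map_sub, coboundary_transgress, sub_neg_eq_add, add_assoc]

end OreExtension

/-! ### Relative periodic cyclic cohomology -/

namespace PeriodicCochain

variable {k E : Type*} [Field k] [Ring E] [Algebra k E]

theorem d_apply_zero (x : PeriodicCochain k E) : d k E x 0 = CyclicCochain.B 0 (x 1) := by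
  suffices h : DirectSum.component k ℕ (CyclicCochain k E) 0 ∘ₗ d k E =
      CyclicCochain.B 0 ∘ₗ DirectSum.component k ℕ (CyclicCochain k E) 1 from
    LinearMap.congr_fun h x
  refine DirectSum.linearMap_ext k fun n => LinearMap.ext fun φ => ?_
  simp only [LinearMap.comp_apply]
  match n, φ with
  | 0, φ =>
    rw [d_lof_zero, DirectSum.component.of, DirectSum.component.of, dif_neg (by omega),
      dif_neg (by omega), map_zero]
  | 1, φ =>
    rw [d_lof_succ, map_add, DirectSum.component.lof_self, DirectSum.component.lof_self,
      DirectSum.component.of, dif_neg (by omega), zero_add]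
  | n + 2, φ =>
    rw [d_lof_succ, map_add, DirectSum.component.of, DirectSum.component.of,
      DirectSum.component.of, dif_neg (by omega), dif_neg (by omega), dif_neg (by omega), map_zero,
      zero_add]

theorem d_apply_succ (x : PeriodicCochain k E) (m : ℕ) :
    d k E x (m + 1) = CyclicCochain.b m (x m) + CyclicCochain.B (m + 1) (x (m + 2)) := by
  suffices h : DirectSum.component k ℕ (CyclicCochain k E) (m + 1) ∘ₗ d k E =
      CyclicCochain.b m ∘ₗ DirectSum.component k ℕ (CyclicCochain k E) m +
      CyclicCochain.B (m + 1) ∘ₗ DirectSum.component k ℕ (CyclicCochain k E) (m + 2) from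
    LinearMap.congr_fun h x
  refine DirectSum.linearMap_ext k fun n => LinearMap.ext fun φ => ?_
  simp only [LinearMap.comp_apply, LinearMap.add_apply]
  match n, φ with
  | 0, φ =>
    rw [d_lof_zero]
    by_cases h : 0 = m
    · subst h
      rw [DirectSum.component.lof_self, DirectSum.component.lof_self, DirectSum.component.of,
        dif_neg (by omega), map_zero, add_zero]
    · rw [DirectSum.component.of, DirectSum.component.of, DirectSum.component.of,
        dif_neg (by omega), dif_neg (by omega), dif_neg (by omega), map_zero, map_zero, add_zero]
  | n + 1, φ =>
    rw [d_lof_succ, map_add]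
    congr 1
    · by_cases h : n + 1 = m
      · subst h
        rw [DirectSum.component.lof_self, DirectSum.component.lof_self]
      · rw [DirectSum.component.of, DirectSum.component.of, dif_neg (by omega),
          dif_neg (by omega), map_zero]
    · by_cases h : n = m + 1
      · subst h
        rw [DirectSum.component.lof_self, DirectSum.component.lof_self]
      · rw [DirectSum.component.of, DirectSum.component.of, dif_neg (by omega),
          dif_neg (by omega), map_zero]

theorem d_mem_ofParity {p : ZMod 2} {x : PeriodicCochain k E} (hx : x ∈ ofParity k E (p + 1)) :
    d k E x ∈ ofParity k E p := by
  have h2 : ∀ q : ZMod 2, q + 1 + 1 = q := by decide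
  intro n hn
  cases n with
  | zero =>
    rw [d_apply_zero, hx 1, map_zero]
    intro h
    exact hn (add_right_cancel (b := (1 : ZMod 2)) (by simpa using h))
  | succ n =>
    rw [d_apply_succ, hx n, hx (n + 2), map_zero, map_zero, add_zero]
    · intro h
      refine hn (add_right_cancel (b := (1 : ZMod 2)) ?_)
      rw [← h]
      push_cast
      ring
    · intro h
      refine hn ?_
      rw [Nat.cast_succ, h, h2]

theorem lof_mem_ofParity {p : ZMod 2} {n : ℕ} (hn : (n : ZMod 2) = p) (φ : CyclicCochain k E n) :
    DirectSum.lof k ℕ (CyclicCochain k E) n φ ∈ ofParity k E p := by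
  intro m hm
  refine (DirectSum.component.of k m n φ).trans (dif_neg ?_)
  rintro rfl
  exact hm hn

end PeriodicCochain

open PeriodicCochain in
theorem PeriodicCochain.pullback_lof {k A E : Type*} [Field k] [Ring A] [Algebra k A] [Ring E]
    [Algebra k E] (f : A →ₐ[k] E) {n : ℕ} (φ : CyclicCochain k E n) :
    pullback f (DirectSum.lof k ℕ (CyclicCochain k E) n φ) =
      DirectSum.lof k ℕ (CyclicCochain k A) n (CyclicCochain.pullback f n φ) :=
  DirectSum.lmap_lof _ _ _

namespace OreExtension

open DualCochain PeriodicCochain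

variable {k A E : Type*} [Field k] [Ring A] [Algebra k A] {δ : A →ₗ[k] A} [Ring E] [Algebra k E]
  (O : OreExtension δ E) {n : ℕ}

theorem exists_of_b_eq_zero_zero [CharZero k] {φ : CyclicCochain k E 0}
    (hφ : CyclicCochain.pullback O.incl 0 φ = 0) (hb : CyclicCochain.b 0 φ = 0) :
    ∃ ψ : CyclicCochain k E 1, CyclicCochain.pullback O.incl 1 ψ = 0 ∧
      CyclicCochain.b 1 ψ = 0 ∧ φ = CyclicCochain.B 0 ψ := by
  obtain ⟨g, hg, hg', h⟩ := exists_eq_connes (isRelative_ofCyclic.2 hφ)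
    (by rw [← ofCyclic_b, hb, map_zero])
  obtain ⟨ψ, rfl⟩ := ofCyclic.surjective g
  refine ⟨ψ, isRelative_ofCyclic.1 hg, ofCyclic.injective ?_, ofCyclic.injective ?_⟩
  · rw [ofCyclic_b, hg', map_zero]
  · rw [h, connes_ofCyclic]

theorem exists_of_b_eq_zero_one [CharZero k] {φ : CyclicCochain k E 1}
    (hφ : CyclicCochain.pullback O.incl 1 φ = 0) (hb : CyclicCochain.b 1 φ = 0)
    (hB : CyclicCochain.B 0 φ = 0) :
    ∃ (ψ : CyclicCochain k E 2) (η : CyclicCochain k E 0),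
      CyclicCochain.pullback O.incl 2 ψ = 0 ∧ CyclicCochain.pullback O.incl 0 η = 0 ∧
      CyclicCochain.b 2 ψ = 0 ∧ φ = CyclicCochain.B 1 ψ + CyclicCochain.b 0 η := by
  obtain ⟨g, h, hg, hg', hh, e⟩ := exists_eq_connes_add_coboundary_one
    (isRelative_ofCyclic.2 hφ) (by rw [← ofCyclic_b, hb, map_zero])
    (by rw [connes_ofCyclic, hB, map_zero])
  obtain ⟨ψ, rfl⟩ := ofCyclic.surjective g
  obtain ⟨η, rfl⟩ := ofCyclic.surjective h
  refine ⟨ψ, η, isRelative_ofCyclic.1 hg, isRelative_ofCyclic.1 hh, ofCyclic.injective ?_,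
    ofCyclic.injective ?_⟩
  · rw [ofCyclic_b, hg', map_zero]
  · rw [e, connes_ofCyclic, ← ofCyclic_b, map_add]

theorem exists_of_b_eq_zero [CharZero k] {φ : CyclicCochain k E (n + 2)}
    (hφ : CyclicCochain.pullback O.incl (n + 2) φ = 0) (hb : CyclicCochain.b (n + 2) φ = 0)
    {ζ : CyclicCochain k E n} (hζ : CyclicCochain.pullback O.incl n ζ = 0)
    (hB : CyclicCochain.B (n + 1) φ = CyclicCochain.b n ζ) :
    ∃ (ψ : CyclicCochain k E (n + 3)) (η : CyclicCochain k E (n + 1)),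
      CyclicCochain.pullback O.incl (n + 3) ψ = 0 ∧ CyclicCochain.pullback O.incl (n + 1) η = 0 ∧
      CyclicCochain.b (n + 3) ψ = 0 ∧
      φ = CyclicCochain.B (n + 2) ψ + CyclicCochain.b (n + 1) η := by
  obtain ⟨g, h, hg, hg', hh, e⟩ := exists_eq_connes_add_coboundary
    (isRelative_ofCyclic.2 hφ) (by rw [← ofCyclic_b, hb, map_zero]) (isRelative_ofCyclic.2 hζ)
    (by rw [connes_ofCyclic, hB, ofCyclic_b])
  obtain ⟨ψ, rfl⟩ := ofCyclic.surjective g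
  obtain ⟨η, rfl⟩ := ofCyclic.surjective h
  refine ⟨ψ, η, isRelative_ofCyclic.1 hg, isRelative_ofCyclic.1 hh, ofCyclic.injective ?_,
    ofCyclic.injective ?_⟩
  · rw [ofCyclic_b, hg', map_zero]
  · rw [e, connes_ofCyclic, ← ofCyclic_b, map_add]

/-- The top component of a relative cocycle can be removed by a relative coboundary. -/
theorem exists_d_apply_eq [CharZero k] {p : ZMod 2} {x : PeriodicCochain k E}
    (hx : x ∈ ofParity k E p) (hd : d k E x = 0) (hx0 : pullback O.incl x = 0) {N : ℕ}
    (hN : ∀ n, N < n → x n = 0) :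
    ∃ y ∈ ofParity k E (p + 1), pullback O.incl y = 0 ∧
      ∀ n, N ≤ n → d k E y n = x n := by
  have hp : ∀ n, CyclicCochain.pullback O.incl n (x n) = 0 := fun n => by
    rw [← DirectSum.lmap_apply]
    exact congrArg (fun z : PeriodicCochain k A => z n) hx0
  have hb : ∀ n, CyclicCochain.b n (x n) + CyclicCochain.B (n + 1) (x (n + 2)) = 0 := fun n => by
    rw [← d_apply_succ, hd]; rfl
  have hbN : CyclicCochain.b N (x N) = 0 := by
    have := hb N
    rwa [hN (N + 2) (by omega), map_zero, add_zero] at this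
  by_cases hNp : (N : ZMod 2) = p
  swap
  · refine ⟨0, zero_mem _, map_zero _, fun n hn => ?_⟩
    rw [map_zero]
    rcases hn.eq_or_lt with rfl | h
    · rw [hx N hNp]; rfl
    · rw [hN n h]; rfl
  have htop : ∀ n, N ≤ n → DirectSum.lof k ℕ (CyclicCochain k E) N (x N) n = x n := fun n hn => by
    rcases hn.eq_or_lt with rfl | h
    · exact DirectSum.component.lof_self k _ _
    · rw [hN n h]
      exact (DirectSum.component.of k n N _).trans (dif_neg h.ne)
  match N with
  | 0 =>
    obtain ⟨ψ, hψ, hψ', e⟩ := O.exists_of_b_eq_zero_zero (hp 0) hbN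
    refine ⟨DirectSum.lof k ℕ (CyclicCochain k E) 1 ψ,
      lof_mem_ofParity (by rw [← hNp]; simp) _, by rw [pullback_lof, hψ, map_zero], fun n hn => ?_⟩
    rw [d_lof_succ, hψ', map_zero, zero_add, ← e, htop n hn]
  | 1 =>
    obtain ⟨ψ, η, hψ, hη, hψ', e⟩ := O.exists_of_b_eq_zero_one (hp 1) hbN
      (by rw [← d_apply_zero, hd]; rfl)
    refine ⟨DirectSum.lof k ℕ (CyclicCochain k E) 2 ψ + DirectSum.lof k ℕ (CyclicCochain k E) 0 η,
      add_mem (lof_mem_ofParity (by rw [← hNp]; rfl) _) (lof_mem_ofParity (by rw [← hNp]; rfl) _),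
      by rw [map_add, pullback_lof, pullback_lof, hψ, hη, map_zero, map_zero, add_zero],
      fun n hn => ?_⟩
    rw [map_add, d_lof_succ, d_lof_zero, hψ', map_zero, zero_add, ← map_add, ← e, htop n hn]
  | N + 2 =>
    have h2 : (2 : ZMod 2) = 0 := rfl
    obtain ⟨ψ, η, hψ, hη, hψ', e⟩ := O.exists_of_b_eq_zero (hp (N + 2)) hbN (ζ := -x N)
      (by rw [map_neg, hp, neg_zero])
      (by rw [map_neg]; exact (neg_eq_of_add_eq_zero_right (hb N)).symm)
    refine ⟨DirectSum.lof k ℕ (CyclicCochain k E) (N + 3) ψ +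
        DirectSum.lof k ℕ (CyclicCochain k E) (N + 1) η,
      add_mem (lof_mem_ofParity (by rw [← hNp]; push_cast; ring) _)
        (lof_mem_ofParity (by rw [← hNp]; push_cast; rw [h2, add_zero]) _),
      by rw [map_add, pullback_lof, pullback_lof, hψ, hη, map_zero, map_zero, add_zero],
      fun n hn => ?_⟩
    rw [map_add, d_lof_succ, d_lof_succ, hψ', map_zero, zero_add, ← add_assoc, ← map_add, ← e,
      DirectSum.add_apply, htop n hn]
    refine add_eq_left.2 ((DirectSum.component.of k n N _).trans (dif_neg ?_))
    omega

theorem exists_d_eq [CharZero k] (N : ℕ) : ∀ {p : ZMod 2} {x : PeriodicCochain k E},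
    x ∈ ofParity k E p → d k E x = 0 → pullback O.incl x = 0 → (∀ n, N ≤ n → x n = 0) →
    ∃ y ∈ ofParity k E (p + 1), pullback O.incl y = 0 ∧ d k E y = x := by
  induction N with
  | zero =>
    intro p x _ _ _ hN
    obtain rfl : x = 0 := DFinsupp.ext fun n => hN n (Nat.zero_le n)
    exact ⟨0, zero_mem _, map_zero _, map_zero _⟩
  | succ N ih =>
    intro p x hx hd hx0 hN
    obtain ⟨y, hy, hy0, hyx⟩ := O.exists_d_apply_eq hx hd hx0 (N := N) fun n hn => hN n hn
    obtain ⟨z, hz, hz0, hzx⟩ := ih (p := p) (x := x - d k E y)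
      (sub_mem hx (d_mem_ofParity hy)) (by rw [map_sub, hd, PeriodicCochain.d_d, sub_zero])
      (by rw [map_sub, pullback_d, hx0, hy0, map_zero, sub_zero])
      (fun n hn => by rw [DirectSum.sub_apply, hyx n hn, sub_self])
    exact ⟨y + z, add_mem hy hz, by rw [map_add, hy0, hz0, add_zero],
      by rw [map_add, hzx, add_sub_cancel]⟩

/-- Relative periodic cyclic cohomology vanishes. -/
theorem exists_d_eq_of_pullback_eq_zero [CharZero k] {p : ZMod 2} {x : PeriodicCochain k E}
    (hx : x ∈ ofParity k E p) (hd : d k E x = 0) (hx0 : pullback O.incl x = 0) :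
    ∃ y ∈ ofParity k E (p + 1), pullback O.incl y = 0 ∧ d k E y = x := by
  classical
  refine O.exists_d_eq ((DFinsupp.support x).sup id + 1) hx hd hx0 fun n hn => ?_
  by_contra h
  have := Finset.le_sup (f := id) (DFinsupp.mem_support_iff.2 h)
  simp only [id] at this
  omega

theorem exists_pullback_eq {p : ZMod 2} {x : PeriodicCochain k A} (hx : x ∈ ofParity k A p) :
    ∃ y ∈ ofParity k E p, pullback O.incl y = x := by
  -- The coefficient of `x⁰` is a linear retraction of `E` onto `A`.
  let P : E →ₗ[k] A := Finsupp.lapply 0 ∘ₗ O.coeff.toLinearMap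
  have hP : ∀ a, P (O.incl a) = a := fun a => by
    have := O.coeff_monomial a 0
    rw [pow_zero, mul_one] at this
    simp [P, this]
  refine ⟨DirectSum.lmap (fun n => MultilinearMap.compLinearMapₗ fun _ => P) x, fun n hn => ?_, ?_⟩
  · rw [DirectSum.lmap_apply, hx n hn, map_zero]
  · refine DFinsupp.ext fun n => ?_
    refine (DirectSum.lmap_apply _ _ _).trans ?_
    rw [DirectSum.lmap_apply]
    refine MultilinearMap.ext fun v => ?_
    rw [CyclicCochain.pullback_apply]
    change x n (fun i => P (O.incl (v i))) = _
    simp only [hP]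

theorem HP_map_bijective [CharZero k] (p : ZMod 2) : Function.Bijective (HP.map O.incl p) := by
  constructor
  · rw [injective_iff_map_eq_zero]
    intro c hc
    obtain ⟨⟨x, hx⟩, rfl⟩ := Submodule.Quotient.mk_surjective _ c
    rw [HP.map, Submodule.mapQ_apply, Submodule.Quotient.mk_eq_zero] at hc
    obtain ⟨y, hy, hyx⟩ := hc
    rw [Submodule.Quotient.mk_eq_zero]
    obtain ⟨y, hy', rfl⟩ := O.exists_pullback_eq hy
    obtain ⟨z, hz, hz0, hzx⟩ := O.exists_d_eq_of_pullback_eq_zero (x := x - d k E y)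
      (sub_mem hx.1 (d_mem_ofParity hy'))
      (by rw [map_sub, PeriodicCochain.d_d, LinearMap.mem_ker.1 hx.2, sub_zero])
      (by rw [map_sub, pullback_d, hyx]; exact sub_self _)
    exact ⟨y + z, add_mem hy' hz, by rw [map_add, hzx, add_sub_cancel]; rfl⟩
  · intro c
    obtain ⟨⟨x, hx⟩, rfl⟩ := Submodule.Quotient.mk_surjective _ c
    obtain ⟨y, hy, rfl⟩ := O.exists_pullback_eq hx.1
    have hp : ∀ q : ZMod 2, q + 1 + 1 = q := by decide
    obtain ⟨z, hz, hz0, hzy⟩ := O.exists_d_eq_of_pullback_eq_zero (p := p + 1) (x := d k E y)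
      (d_mem_ofParity (by rwa [hp])) (PeriodicCochain.d_d y) (by rw [pullback_d]; exact hx.2)
    rw [hp] at hz
    refine ⟨Submodule.Quotient.mk ⟨y - z, sub_mem hy hz, ?_⟩, ?_⟩
    · exact LinearMap.mem_ker.2 (by rw [map_sub, hzy, sub_self])
    · rw [HP.map, Submodule.mapQ_apply]
      congr 1
      refine Subtype.ext ?_
      change pullback O.incl (y - z) = _
      rw [map_sub, hz0, sub_zero]

end OreExtension

/-! ### The crossed product as an Ore extension -/

/-- The crossed product of `A` by `k[x]`, `x` acting as `δ`, is the Ore extension `A[x; δ]`. -/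
def derivationOreExtension {k : Type*} [Field k] {A : Type*} [Ring A] [Algebra k A]
    (δ : A →ₗ[k] A) (hδ : ∀ a b : A, δ (a * b) = δ a * b + a * δ b) :
    OreExtension δ (derivationAction δ hδ).CrossedProduct where
  incl := (derivationAction δ hδ).incl
  var := (derivationAction δ hδ).tmul 1 Polynomial.X
  coeff := (TensorProduct.congr (LinearEquiv.refl k A) (Polynomial.basisMonomials k).repr) ≪≫ₗ
    TensorProduct.finsuppScalarRight k k A ℕ
  coeff_monomial a m := by
    have h : ∀ m : ℕ, (derivationAction δ hδ).incl a *
        (derivationAction δ hδ).tmul 1 Polynomial.X ^ m =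
        (derivationAction δ hδ).tmul a (Polynomial.X ^ m) := by
      intro m
      induction m with
      | zero => rw [pow_zero, pow_zero, mul_one]; rfl
      | succ m ih =>
        rw [pow_succ, ← mul_assoc, ih, pow_succ, ModuleAlgebra.mul_def]
        change ModuleAlgebra.mulMap _ (_ ⊗ₜ _) (_ ⊗ₜ _) = _ ⊗ₜ _
        rw [ModuleAlgebra.mulMap_tmul, ModuleAlgebra.twist_one_left]
        simp [← Polynomial.X_mul]
    rw [h]
    change TensorProduct.finsuppScalarRight k k A ℕ (TensorProduct.congr (LinearEquiv.refl k A)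
      (Polynomial.basisMonomials k).repr (a ⊗ₜ _)) = _
    rw [TensorProduct.congr_tmul]
    have : (Polynomial.basisMonomials k).repr (Polynomial.X ^ m) = Finsupp.single m 1 := by
      rw [← Polynomial.monomial_one_right_eq_X_pow]
      exact (Polynomial.basisMonomials k).repr_self m
    rw [this]
    ext i
    simp [Finsupp.single_apply, TensorProduct.finsuppScalarRight_apply_tmul_apply]
  var_mul_incl a := by
    rw [ModuleAlgebra.mul_def, ModuleAlgebra.mul_def]
    change ModuleAlgebra.mulMap _ (_ ⊗ₜ _) (_ ⊗ₜ _) =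
      ModuleAlgebra.mulMap _ (_ ⊗ₜ _) (_ ⊗ₜ _) + _ ⊗ₜ _
    rw [ModuleAlgebra.mulMap_tmul, ModuleAlgebra.mulMap_tmul, ModuleAlgebra.twist_one_right,
      ModuleAlgebra.twist_repr _ a Polynomial.X Finset.univ ![Polynomial.X, 1]
        ![1, Polynomial.X] (by simp [polynomial_comul_X])]
    simp [derivationAction, add_comm]
    rfl

end

/-- For a locally nilpotent derivation `δ` of an algebra `A` over a field of characteristic zero,
the inclusion `A → A ⋊ k[x]` induces an isomorphism `HP^*(A ⋊ k[x]) ≅ HP^*(A)`. -/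
theorem mainTheorem11
    {k : Type*} [Field k] [CharZero k] {A : Type*} [Ring A] [Algebra k A]
    (δ : A →ₗ[k] A) (hδ : ∀ a b : A, δ (a * b) = δ a * b + a * δ b)
    (hnil : ∀ a : A, ∃ n : ℕ, 0 < n ∧ (δ ^ n) a = 0) (p : ZMod 2) :
    ∃ e : HP k (derivationAction δ hδ).CrossedProduct p ≃ₗ[k] HP k A p,
      ∀ x, e x = HP.map (derivationAction δ hδ).incl p x :=
  ⟨LinearEquiv.ofBijective _ ((derivationOreExtension δ hδ).HP_map_bijective p), fun _ => rfl⟩
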